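/- **Setting.** Let $A$ be a set of actions containing a termination action $\surd$. A *PGSOS specification* $P=(\Sigma,A,R)$ consists of a signature $\Sigma$ (operators with finite ranks) and a set $R$ of rules $$\frac{\{x_i\xrightarrow{a_{i,k}}\mu_{i,k}\mid k\in K_i\}\quad\{x_i\not\xrightarrow{b_{i,l}}\ \mid l\in L_i\}\qquad(1\le i\le n)}{f(x_1,\dots,x_n)\xrightarrow{a}\theta}$$ with $K_i,L_i$ finite, all $x_i$ and all $\mu_{i,k}$ pairwise distinct, and $\theta$ a distribution term built from the $\mu_{i,k}$, Dirac terms $\delta(t)$ with $t$ a term over the $x_i$, convex combinations ($\theta_1\oplus_p\theta_2$ has weights $p$ and $1-p$) and operators of $\Sigma$ (interpreted as product distributions), such that for every operator $f$ and action $a$ only finitely many rules have source operator $f$ and label $a$. It induces a unique transition relation $t\xrightarrow{a}\pi$ between closed $\Sigma$-terms $t\in T(\Sigma)$ and discrete probability distributions $\pi$ on $T(\Sigma)$, containing exactly the transitions justified by an instance of a rule. For $0<\lambda<1$, a *$\lambda$-bisimulation metric* is a $1$-bounded pseudometric $d$ on $T(\Sigma)$ such that whenever $d(t,t')<1$ and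 $t\xrightarrow{a}\pi$ there is $t'\xrightarrow{a}\pi'$ with $\lambda\,\mathbf K(d)(\pi,\pi')\le d(t,t')$, where $\mathbf K(d)(\pi,\pi')=\min_\omega\sum_{u,u'}d(u,u')\,\omega(u,u')$, the minimum being over all distributions $\omega$ on $T(\Sigma)\times T(\Sigma)$ with marginals $\pi,\pi'$. The *$\lambda$-bisimilarity metric* $\mathbf d_\lambda$ is the pointwise smallest $\lambda$-bisimulation metric. **The process algebra.** Let $P_{\mathrm{PA}^\circlearrowleft}$ be the specification with the following operators and rules ($p\in(0,1)$, $B\subseteq A$, $n,m\in\mathbb N$, $a\in A$; rules marked $\dagger$ are restricted to $a\ne\surd$). - $0$: no rule. $\varepsilon$: $\varepsilon\xrightarrow{\surd}\delta(0)$. Prefix ($k\ge1$, $p_i>0$, $\sum_{i=1}^k p_i=1$): $a.\bigoplus_{i=1}^k[p_i]x_i\xrightarrow{a}\sum_{i=1}^k p_i\delta(x_i)$. - $x;y$: $\dfrac{x\xrightarrow a\mu}{x;y\xrightarrow a\mu;\delta(y)}\dagger$, $\dfrac{x\xrightarrow\surd\mu\ \ y\xrightarrow a\nu}{x;y\xrightarrow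 a\nu}$. - $x+y$: $\dfrac{x\xrightarrow a\mu}{x+y\xrightarrow a\mu}$, $\dfrac{y\xrightarrow a\nu}{x+y\xrightarrow a\nu}$. - $x+_py$: $\dfrac{x\xrightarrow a\mu\ \ y\not\xrightarrow a}{x+_py\xrightarrow a\mu}$, $\dfrac{x\not\xrightarrow a\ \ y\xrightarrow a\nu}{x+_py\xrightarrow a\nu}$, $\dfrac{x\xrightarrow a\mu\ \ y\xrightarrow a\nu}{x+_py\xrightarrow a\mu\oplus_p\nu}$. - All four parallel operators $\circ\in\{\mid,\ |||,\ |||_p,\ \parallel_B\}$ have the rule $\dfrac{x\xrightarrow\surd\mu\ \ y\xrightarrow\surd\nu}{x\circ y\xrightarrow\surd\delta(0)}$. In addition: $x\mid y$ has $\dfrac{x\xrightarrow a\mu\ \ y\xrightarrow a\nu}{x\mid y\xrightarrow a\mu\mid\nu}\dagger$; $x\,|||\,y$ has $\dfrac{x\xrightarrow a\mu}{x|||y\xrightarrow a\mu|||\delta(y)}\dagger$ and $\dfrac{y\xrightarrow a\nu}{x|||y\xrightarrow a\delta(x)|||\nu}\dagger$; $x\,|||_p\,y$ has $\dfrac{x\xrightarrow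 a\mu\ \ y\not\xrightarrow a}{x|||_py\xrightarrow a\mu|||_p\delta(y)}\dagger$, $\dfrac{x\not\xrightarrow a\ \ y\xrightarrow a\nu}{x|||_py\xrightarrow a\delta(x)|||_p\nu}\dagger$ and $\dfrac{x\xrightarrow a\mu\ \ y\xrightarrow a\nu}{x|||_py\xrightarrow a(\mu|||_p\delta(y))\oplus_p(\delta(x)|||_p\nu)}\dagger$; $x\parallel_By$ has the rule of $\mid$ for $a\in B\setminus\{\surd\}$ and the two rules of $|||$ for $a\notin B\cup\{\surd\}$ (with $\parallel_B$ in place of $\mid$ and $|||$). - Finite iteration $x^n$: $\dfrac{x\xrightarrow a\mu}{x^{n+1}\xrightarrow a\mu;\delta(x^n)}\dagger$, $\dfrac{x\xrightarrow\surd\mu}{x^{n+1}\xrightarrow\surd\mu}$, $x^0\xrightarrow\surd\delta(0)$, $\dfrac{x\xrightarrow\surd\mu\ \ x\xrightarrow a\nu}{x^n\xrightarrow a\nu;\delta(x^m)}\dagger\ (m<n)$. - Infinite iteration $x^\omega$: $\dfrac{x\xrightarrow a\mu}{x^\omega\xrightarrow a\mu;\delta(x^\omega)}\dagger$. - Nondeterministic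 Kleene star $x^*y$: $\dfrac{x\xrightarrow a\mu}{x^*y\xrightarrow a\mu;\delta(x^*y)}\dagger$, $\dfrac{y\xrightarrow a\nu}{x^*y\xrightarrow a\nu}$. - Probabilistic Kleene star $x^{*_p}y$: $\dfrac{x\xrightarrow a\mu\ \ y\xrightarrow a\nu}{x^{*_p}y\xrightarrow a\nu\oplus_p(\mu;\delta(x^{*_p}y))}\dagger$, $\dfrac{x\xrightarrow a\mu\ \ y\not\xrightarrow a}{x^{*_p}y\xrightarrow a\mu;\delta(x^{*_p}y)}\dagger$, $\dfrac{x\not\xrightarrow a\ \ y\xrightarrow a\nu}{x^{*_p}y\xrightarrow a\nu}\dagger$, $\dfrac{y\xrightarrow\surd\nu}{x^{*_p}y\xrightarrow\surd\nu}$. - Finite replication $!^nx$: $\dfrac{x\xrightarrow a\mu}{!^{n+1}x\xrightarrow a\mu|||\delta(!^nx)}\dagger$, $\dfrac{x\xrightarrow\surd\mu}{!^{n+1}x\xrightarrow\surd\mu}$, $!^0x\xrightarrow\surd\delta(0)$. - Infinite replication (bang) $!x$: $\dfrac{x\xrightarrow a\mu}{!x\xrightarrow a\mu|||\delta(!x)}\dagger$;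 probabilistic bang $!_px$: $\dfrac{x\xrightarrow a\mu}{!_px\xrightarrow a\mu\oplus_p(\mu|||\delta(!_px))}\dagger$. **Theorem.** Let $P=(\Sigma,A,R)$ be a PGSOS specification that is a disjoint extension of $P_{\mathrm{PA}^\circlearrowleft}$, i.e. it contains all operators and rules of $P_{\mathrm{PA}^\circlearrowleft}$ and no further rule for an operator of $P_{\mathrm{PA}^\circlearrowleft}$, and let $\lambda\in(0,1)$. Then the $\lambda$-bisimilarity metric $\mathbf d_\lambda$ on $T(\Sigma)$ exists, and infinite iteration, nondeterministic Kleene star, probabilistic Kleene star (for every $p\in(0,1)$) and infinite replication are Lipschitz continuous with respect to $\mathbf d_\lambda$ with Lipschitz factor $K=\frac1{1-\lambda}$; that is, for all $s,t,s_1,s_2,t_1,t_2\in T(\Sigma)$, $$\mathbf d_\lambda(s^\omega,t^\omega)\le\tfrac{1}{1-\lambda}\,\mathbf d_\lambda(s,t),\qquad \mathbf d_\lambda(!s,!t)\le\tfrac{1}{1-\lambda}\,\mathbf d_\lambda(s,t),$$ $$\mathbf d_\lambda(s_1{}^{*}s_2,t_1{}^{*}t_2)\le\tfrac{1}{1-\lambda}\big(\mathbf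 d_\lambda(s_1,t_1)+\mathbf d_\lambda(s_2,t_2)\big),\qquad \mathbf d_\lambda(s_1{}^{*_p}s_2,t_1{}^{*_p}t_2)\le\tfrac{1}{1-\lambda}\big(\mathbf d_\lambda(s_1,t_1)+\mathbf d_\lambda(s_2,t_2)\big).$$ -/

import Mathlib

noncomputable section

namespace ProcCalc

universe u v w x

/-! ### Signatures, terms, distribution terms -/

/-- A signature: `S n` is the type of operators of rank `n`. -/
abbrev Signature := ℕ → Type v

/-- State terms over `S` with state variables in `V`. -/
inductive Term (S : Signature.{v}) (V : Type w) : Type (max v w)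
  | var (x : V) : Term S V
  | op {n : ℕ} (f : S n) (ts : Fin n → Term S V) : Term S V

/-- Closed state terms, also called processes. -/
abbrev Proc (S : Signature.{v}) : Type v := Term S Empty

/-- Substitution of terms for the state variables. -/
def Term.subst {S : Signature.{v}} {V : Type w} {W : Type x} (σ : V → Term S W) :
    Term S V → Term S W
  | .var x => σ x
  | .op f ts => .op f (fun i => (ts i).subst σ)

/-- Renaming of the operators along a rank-preserving map of signatures. -/
def Term.mapSig {S S' : Signature} (ι : ∀ n, S n → S' n) {V : Type w} : Term S V → Term S' V
  | .var x => .var x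
  | .op f ts => .op (ι _ f) (fun i => (ts i).mapSig ι)

/-- Distribution terms over `S` with state variables in `V` and distribution variables in `D`.
A weight `PMF I` has countable support, so `mix` is exactly the countable convex combination. -/
inductive DTerm (S : Signature.{v}) (V : Type w) (D : Type x) : Type (max v w x 1)
  | var (μ : D) : DTerm S V D
  | dirac (t : Term S V) : DTerm S V D
  | mix {I : Type} (p : PMF I) (θ : I → DTerm S V D) : DTerm S V D
  | op {n : ℕ} (f : S n) (θ : Fin n → DTerm S V D) : DTerm S V D

/-- Renaming of the operators in a distribution term. -/
def DTerm.mapSig {S S' : Signature} (ι : ∀ n, S n → S' n) {V : Type w} {D : Type x} :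
    DTerm S V D → DTerm S' V D
  | .var μ => .var μ
  | .dirac t => .dirac (t.mapSig ι)
  | .mix p θ => .mix p (fun i => (θ i).mapSig ι)
  | .op f θ => .op (ι _ f) (fun i => (θ i).mapSig ι)

/-- The product of finitely many discrete distributions. -/
def piPMF {α : Type w} : {n : ℕ} → (Fin n → PMF α) → PMF (Fin n → α)
  | 0, _ => PMF.pure Fin.elim0
  | _ + 1, π => (π 0).bind fun x => (piPMF (Fin.tail π)).map (Fin.cons x)

theorem piPMF_apply {α : Type w} {n : ℕ} (π : Fin n → PMF α) (y : Fin n → α) :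
    piPMF π y = ∏ i, π i (y i) := by
  classical
  induction n with
  | zero =>
    have : y = Fin.elim0 := Subsingleton.elim _ _
    simp [piPMF, this]
  | succ n ih =>
    rw [Fin.prod_univ_succ]
    simp only [piPMF, PMF.bind_apply, PMF.map_apply]
    rw [tsum_eq_single (y 0)]
    · rw [tsum_eq_single (Fin.tail y)]
      · simp [ih, Fin.tail]
      · intro z hz
        rw [if_neg]
        intro h
        exact hz (by rw [h, Fin.tail_cons])
    · intro z hz
      rw [mul_eq_zero]
      right
      rw [ENNReal.tsum_eq_zero]
      intro w
      rw [if_neg]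
      intro h
      exact hz (by rw [h, Fin.cons_zero])

/-- The distribution denoted by a distribution term when the state variables stand for processes
and the distribution variables for distributions; `f(π₁, …, πₙ)` is the product distribution
transported along `f`. -/
def DTerm.eval {S : Signature.{v}} {V : Type w} {D : Type x} (σ : V → Proc S)
    (ρ : D → PMF (Proc S)) : DTerm S V D → PMF (Proc S)
  | .var μ => ρ μ
  | .dirac t => PMF.pure (t.subst σ)
  | .mix p θ => p.bind fun i => (θ i).eval σ ρ
  | .op f θ => (piPMF fun i => (θ i).eval σ ρ).map (Term.op f)

/-! ### PGSOS specifications -/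

/-- A PGSOS rule without its source operator `f` (of rank `n`) and its label. The source variables
are `x_i`, `i : Fin n`. The positive premises are `x_i -b-> μ_k` with `(i, b) = pos k` for
`k : Fin numPos`, so the distribution variables are pairwise distinct; the negative premises say
that `x_i` has no `b`-transition, for `(i, b) ∈ neg`. The target has no other variables. -/
structure Rule (S : Signature.{v}) (A : Type u) (n : ℕ) where
  numPos : ℕ
  pos : Fin numPos → Fin n × A
  neg : Finset (Fin n × A)
  target : DTerm S (Fin n) (Fin numPos)

/-- Renaming of the operators in a rule. -/
def Rule.mapSig {S S' : Signature} (ι : ∀ n, S n → S' n) {A : Type u} {n : ℕ}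
    (r : Rule S A n) : Rule S' A n where
  numPos := r.numPos
  pos := r.pos
  neg := r.neg
  target := r.target.mapSig ι

/-- A probabilistic transition system specification in PGSOS format: `rules f a` is the finite set
of the rules with source operator `f` and label `a`. -/
structure PTSS (S : Signature.{v}) (A : Type u) where
  rules : {n : ℕ} → S n → A → Set (Rule S A n)
  finite_rules : ∀ {n : ℕ} (f : S n) (a : A), (rules f a).Finite

/-- `P'` is a disjoint extension of `P`: the signature of `P` is contained in that of `P'`, all
rules of `P` are rules of `P'`, and `P'` has no other rule for an operator of `P`. -/
structure IsDisjointExtension {S S' : Signature} {A : Type u} (ι : ∀ n, S n → S' n)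
    (P : PTSS S A) (P' : PTSS S' A) : Prop where
  injective : ∀ n, Function.Injective (ι n)
  rules_eq : ∀ {n : ℕ} (f : S n) (a : A), P'.rules (ι n f) a = Rule.mapSig ι '' P.rules f a

/-- The transition relation of a probabilistic transition system on the processes over `S`. -/
abbrev PTS (S : Signature.{v}) (A : Type u) := Proc S → A → PMF (Proc S) → Prop

/-- `M` contains exactly the transitions `t -a-> π` that some rule of `P` justifies in `M`. -/
def IsSupportedModel {S : Signature.{v}} {A : Type u} (P : PTSS S A) (M : PTS S A) : Prop :=
  ∀ (t : Proc S) (a : A) (π : PMF (Proc S)), M t a π ↔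
    ∃ (n : ℕ) (f : S n) (σ : Fin n → Proc S), ∃ r ∈ P.rules f a,
      ∃ ρ : Fin r.numPos → PMF (Proc S),
        (∀ k, M (σ (r.pos k).1) (r.pos k).2 (ρ k)) ∧
        (∀ q ∈ r.neg, ∀ π', ¬ M (σ q.1) q.2 π') ∧
        t = .op f σ ∧ π = r.target.eval σ ρ

/-- The induced model of `P`, by recursion on the source term; it is the unique supported model,
see `isSupportedModel_iff`. -/
def PTSS.model {S : Signature.{v}} {A : Type u} (P : PTSS S A) : PTS S A
  | .var x => x.elim
  | .op f ts => fun a π => ∃ r ∈ P.rules f a, ∃ ρ : Fin r.numPos → PMF (Proc S),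
      (∀ k, P.model (ts (r.pos k).1) (r.pos k).2 (ρ k)) ∧
      (∀ q ∈ r.neg, ∀ π', ¬ P.model (ts q.1) q.2 π') ∧
      π = r.target.eval ts ρ

theorem isSupportedModel_iff {S : Signature.{v}} {A : Type u} (P : PTSS S A) (M : PTS S A) :
    IsSupportedModel P M ↔ M = P.model := by
  constructor
  · intro h
    funext t
    induction t with
    | var x => exact x.elim
    | op f ts ih =>
      funext a π
      apply propext
      rw [h]
      simp only [PTSS.model]
      constructor
      · rintro ⟨n, g, σ, r, hr, ρ, hp, hn, ht, hπ⟩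
        cases ht
        exact ⟨r, hr, ρ, fun k => by rw [← ih]; exact hp k,
          fun q hq π' => by rw [← ih]; exact hn q hq π', hπ⟩
      · rintro ⟨r, hr, ρ, hp, hn, hπ⟩
        exact ⟨_, f, ts, r, hr, ρ, fun k => by rw [ih]; exact hp k,
          fun q hq π' => by rw [ih]; exact hn q hq π', rfl, hπ⟩
  · rintro rfl t a π
    constructor
    · cases t with
      | var x => exact x.elim
      | op f ts =>
        intro h
        simp only [PTSS.model] at h
        obtain ⟨r, hr, ρ, hp, hn, hπ⟩ := h
        exact ⟨_, f, ts, r, hr, ρ, hp, hn, rfl, hπ⟩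
    · rintro ⟨n, f, σ, r, hr, ρ, hp, hn, rfl, hπ⟩
      simp only [PTSS.model]
      exact ⟨r, hr, ρ, hp, hn, hπ⟩

/-! ### The bisimilarity metric -/

/-- A `1`-bounded pseudometric. -/
structure IsPseudometric {T : Type w} (d : T → T → ℝ) : Prop where
  nonneg : ∀ t t', 0 ≤ d t t'
  le_one : ∀ t t', d t t' ≤ 1
  self : ∀ t, d t t = 0
  symm : ∀ t t', d t t' = d t' t
  triangle : ∀ t t' t'', d t t' ≤ d t t'' + d t'' t'

/-- The matchings of two distributions. -/
def matchings {T : Type w} (π π' : PMF T) : Set (PMF (T × T)) :=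
  {ω | ω.map Prod.fst = π ∧ ω.map Prod.snd = π'}

/-- The Kantorovich lifting of `d`. -/
def kantorovich {T : Type w} (d : T → T → ℝ) (π π' : PMF T) : ℝ :=
  sInf ((fun ω : PMF (T × T) => ∑' q : T × T, d q.1 q.2 * (ω q).toReal) '' matchings π π')

/-- `d` is a `lam`-bisimulation metric on the transition system `M`. -/
def IsBisimulationMetric {S : Signature.{v}} {A : Type u} (M : PTS S A) (lam : ℝ)
    (d : Proc S → Proc S → ℝ) : Prop :=
  IsPseudometric d ∧
    ∀ t t', d t t' < 1 → ∀ a π, M t a π → ∃ π', M t' a π' ∧ lam * kantorovich d π π' ≤ d t t'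

/-- The `lam`-bisimilarity metric, the smallest `lam`-bisimulation metric, given as the pointwise
infimum of all `lam`-bisimulation metrics. -/
def bisimilarityMetric {S : Signature.{v}} {A : Type u} (M : PTS S A) (lam : ℝ)
    (s t : Proc S) : ℝ :=
  sInf {c | ∃ d, IsBisimulationMetric M lam d ∧ d s t = c}

/-- The operator `f` is `K`-Lipschitz continuous with respect to `d`. -/
def IsLipschitzOp {S : Signature.{v}} (d : Proc S → Proc S → ℝ) (K : ℝ) {n : ℕ} (f : S n) :
    Prop :=
  0 ≤ K ∧ ∀ s t : Fin n → Proc S, d (.op f s) (.op f t) ≤ K * ∑ i, d (s i) (t i)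

/-! ### The probabilistic process algebra with recursion -/

/-- The operators of the process algebra over the actions `A`. -/
inductive PAOp (A : Type u) : Signature.{u}
  /-- the inactive process `0` -/
  | nil : PAOp A 0
  /-- the skip process `ε` -/
  | skip : PAOp A 0
  /-- probabilistic prefix `a.([p₁]_ ⊕ ⋯ ⊕ [pₙ]_)` with all `pᵢ > 0` -/
  | pre {n : ℕ} (a : A) (p : PMF (Fin n)) (hp : ∀ i, p i ≠ 0) : PAOp A n
  /-- sequential composition `x ; y` -/
  | seq : PAOp A 2
  /-- alternative composition `x + y` -/
  | alt : PAOp A 2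
  /-- probabilistic alternative composition `x +_p y` -/
  | altP (p : Set.Ioo (0 : ℝ) 1) : PAOp A 2
  /-- synchronous parallel composition `x | y` -/
  | sync : PAOp A 2
  /-- asynchronous parallel composition `x ||| y` -/
  | async : PAOp A 2
  /-- probabilistic parallel composition `x |||_p y` -/
  | asyncP (p : Set.Ioo (0 : ℝ) 1) : PAOp A 2
  /-- CSP-like parallel composition with synchronization on the actions in `B` -/
  | par (B : Set A) : PAOp A 2
  /-- finite iteration `x^n` -/
  | iter (n : ℕ) : PAOp A 1
  /-- infinite iteration `x^ω` -/
  | omega : PAOp A 1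
  /-- nondeterministic Kleene star `x^* y` -/
  | star : PAOp A 2
  /-- probabilistic Kleene star `x^{*_p} y` -/
  | starP (p : Set.Ioo (0 : ℝ) 1) : PAOp A 2
  /-- finite replication `!^n x` -/
  | repl (n : ℕ) : PAOp A 1
  /-- infinite replication (bang) `! x` -/
  | bang : PAOp A 1
  /-- probabilistic bang `!_p x` -/
  | bangP (p : Set.Ioo (0 : ℝ) 1) : PAOp A 1

/-- The distribution on `Bool` with weight `p` on `true` and `1 - p` on `false`. -/
def coin (p : Set.Ioo (0 : ℝ) 1) : PMF Bool :=
  PMF.ofFintype (fun b => bif b then ENNReal.ofReal p else ENNReal.ofReal (1 - p)) (by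
    have h0 := p.2.1
    have h1 := p.2.2
    rw [Fintype.sum_bool, cond_true, cond_false, ← ENNReal.ofReal_add h0.le (by linarith)]
    simp)

section DistributionTerms

variable {A : Type u} {V : Type w} {D : Type x}

/-- The distribution term `θ₁ ⊕_p θ₂`. -/
def dMix (p : Set.Ioo (0 : ℝ) 1) (θ₁ θ₂ : DTerm (PAOp A) V D) : DTerm (PAOp A) V D :=
  .mix (coin p) (fun b => bif b then θ₁ else θ₂)

/-- The distribution term `f(θ)`. -/
def d1 (f : PAOp A 1) (θ : DTerm (PAOp A) V D) : DTerm (PAOp A) V D := .op f ![θ]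

/-- The distribution term `f(θ₁, θ₂)`. -/
def d2 (f : PAOp A 2) (θ₁ θ₂ : DTerm (PAOp A) V D) : DTerm (PAOp A) V D := .op f ![θ₁, θ₂]

/-- The distribution term `δ(0)`. -/
def dNil : DTerm (PAOp A) V D := .dirac (.op .nil ![])

/-- The distribution term `δ(x)` for a state variable `x`. -/
def dVar (i : V) : DTerm (PAOp A) V D := .dirac (.var i)

/-- The distribution term `δ(f(x))` for a state variable `x`. -/
def dOp1 (f : PAOp A 1) (i : V) : DTerm (PAOp A) V D := .dirac (.op f ![.var i])

/-- The distribution term `δ(f(x, y))` for state variables `x`, `y`. -/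
def dOp2 (f : PAOp A 2) (i j : V) : DTerm (PAOp A) V D := .dirac (.op f ![.var i, .var j])

end DistributionTerms

/-- The rules with source operator `f` and label `a`; `tick` is the action `√` of successful
termination. The state variables are `x = 0` and `y = 1`, and `.var k` is the distribution variable
of the `k`-th positive premise. -/
def paRules {A : Type u} (tick : A) : {n : ℕ} → PAOp A n → A → Set (Rule (PAOp A) A n)
  | _, .nil, _ => ∅
  | _, .skip, a => {r | a = tick ∧ r = ⟨0, ![], ∅, dNil⟩}
  | _, .pre b p _, a => {r | a = b ∧ r = ⟨0, ![], ∅, .mix p (fun i => dVar i)⟩}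
  | _, .seq, a =>
      {r | a ≠ tick ∧ r = ⟨1, ![(0, a)], ∅, d2 .seq (.var 0) (dVar 1)⟩} ∪
      {r | r = ⟨2, ![(0, tick), (1, a)], ∅, .var 1⟩}
  | _, .alt, a =>
      {r | r = ⟨1, ![(0, a)], ∅, .var 0⟩} ∪
      {r | r = ⟨1, ![(1, a)], ∅, .var 0⟩}
  | _, .altP p, a =>
      {r | r = ⟨1, ![(0, a)], {(1, a)}, .var 0⟩} ∪
      {r | r = ⟨1, ![(1, a)], {(0, a)}, .var 0⟩} ∪
      {r | r = ⟨2, ![(0, a), (1, a)], ∅, dMix p (.var 0) (.var 1)⟩}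
  | _, .sync, a =>
      {r | a ≠ tick ∧ r = ⟨2, ![(0, a), (1, a)], ∅, d2 .sync (.var 0) (.var 1)⟩} ∪
      {r | a = tick ∧ r = ⟨2, ![(0, tick), (1, tick)], ∅, dNil⟩}
  | _, .async, a =>
      {r | a ≠ tick ∧ r = ⟨1, ![(0, a)], ∅, d2 .async (.var 0) (dVar 1)⟩} ∪
      {r | a ≠ tick ∧ r = ⟨1, ![(1, a)], ∅, d2 .async (dVar 0) (.var 0)⟩} ∪
      {r | a = tick ∧ r = ⟨2, ![(0, tick), (1, tick)], ∅, dNil⟩}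
  | _, .asyncP p, a =>
      {r | a ≠ tick ∧ r = ⟨1, ![(0, a)], {(1, a)}, d2 (.asyncP p) (.var 0) (dVar 1)⟩} ∪
      {r | a ≠ tick ∧ r = ⟨1, ![(1, a)], {(0, a)}, d2 (.asyncP p) (dVar 0) (.var 0)⟩} ∪
      {r | a ≠ tick ∧ r = ⟨2, ![(0, a), (1, a)], ∅,
        dMix p (d2 (.asyncP p) (.var 0) (dVar 1)) (d2 (.asyncP p) (dVar 0) (.var 1))⟩} ∪
      {r | a = tick ∧ r = ⟨2, ![(0, tick), (1, tick)], ∅, dNil⟩}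
  | _, .par B, a =>
      {r | (a ∈ B ∧ a ≠ tick) ∧ r = ⟨2, ![(0, a), (1, a)], ∅, d2 (.par B) (.var 0) (.var 1)⟩} ∪
      {r | a = tick ∧ r = ⟨2, ![(0, tick), (1, tick)], ∅, dNil⟩} ∪
      {r | (a ∉ B ∧ a ≠ tick) ∧ r = ⟨1, ![(0, a)], ∅, d2 (.par B) (.var 0) (dVar 1)⟩} ∪
      {r | (a ∉ B ∧ a ≠ tick) ∧ r = ⟨1, ![(1, a)], ∅, d2 (.par B) (dVar 0) (.var 0)⟩}
  | _, .iter n, a =>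
      {r | ∃ m < n, (a ≠ tick ∧ n = m + 1) ∧
        r = ⟨1, ![(0, a)], ∅, d2 .seq (.var 0) (dOp1 (.iter m) 0)⟩} ∪
      {r | (a = tick ∧ 0 < n) ∧ r = ⟨1, ![(0, tick)], ∅, .var 0⟩} ∪
      {r | (a = tick ∧ n = 0) ∧ r = ⟨0, ![], ∅, dNil⟩} ∪
      {r | ∃ m < n, a ≠ tick ∧
        r = ⟨2, ![(0, tick), (0, a)], ∅, d2 .seq (.var 1) (dOp1 (.iter m) 0)⟩}
  | _, .omega, a =>
      {r | a ≠ tick ∧ r = ⟨1, ![(0, a)], ∅, d2 .seq (.var 0) (dOp1 .omega 0)⟩}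
  | _, .star, a =>
      {r | a ≠ tick ∧ r = ⟨1, ![(0, a)], ∅, d2 .seq (.var 0) (dOp2 .star 0 1)⟩} ∪
      {r | r = ⟨1, ![(1, a)], ∅, .var 0⟩}
  | _, .starP p, a =>
      {r | a ≠ tick ∧ r = ⟨2, ![(0, a), (1, a)], ∅,
        dMix p (.var 1) (d2 .seq (.var 0) (dOp2 (.starP p) 0 1))⟩} ∪
      {r | a ≠ tick ∧ r = ⟨1, ![(0, a)], {(1, a)}, d2 .seq (.var 0) (dOp2 (.starP p) 0 1)⟩} ∪
      {r | a ≠ tick ∧ r = ⟨1, ![(1, a)], {(0, a)}, .var 0⟩} ∪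
      {r | a = tick ∧ r = ⟨1, ![(1, tick)], ∅, .var 0⟩}
  | _, .repl n, a =>
      {r | ∃ m < n, (a ≠ tick ∧ n = m + 1) ∧
        r = ⟨1, ![(0, a)], ∅, d2 .async (.var 0) (dOp1 (.repl m) 0)⟩} ∪
      {r | (a = tick ∧ 0 < n) ∧ r = ⟨1, ![(0, tick)], ∅, .var 0⟩} ∪
      {r | (a = tick ∧ n = 0) ∧ r = ⟨0, ![], ∅, dNil⟩}
  | _, .bang, a =>
      {r | a ≠ tick ∧ r = ⟨1, ![(0, a)], ∅, d2 .async (.var 0) (dOp1 .bang 0)⟩}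
  | _, .bangP p, a =>
      {r | a ≠ tick ∧ r = ⟨1, ![(0, a)], ∅,
        dMix p (.var 0) (d2 .async (.var 0) (dOp1 (.bangP p) 0))⟩}

theorem finite_and_eq {α : Type w} (p : Prop) (c : α) : {r | p ∧ r = c}.Finite :=
  (Set.finite_singleton c).subset fun _ h => h.2

theorem finite_lt_and_eq {α : Type w} (n : ℕ) (p : ℕ → Prop) (c : ℕ → α) :
    {r | ∃ m < n, p m ∧ r = c m}.Finite :=
  ((Set.finite_Iio n).image c).subset fun _ ⟨m, hm, _, h⟩ => ⟨m, hm, h.symm⟩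

theorem finite_paRules {A : Type u} (tick : A) {n : ℕ} (f : PAOp A n) (a : A) :
    (paRules tick f a).Finite := by
  cases f <;> simp only [paRules]
  case nil => exact Set.finite_empty
  all_goals
    repeat' apply Set.Finite.union
    all_goals first
      | exact finite_and_eq _ _
      | exact Set.finite_singleton _
      | exact finite_lt_and_eq _ _ _

/-- The specification of the process algebra with recursion. -/
def paSpec {A : Type u} (tick : A) : PTSS (PAOp A) A where
  rules := paRules tick
  finite_rules := finite_paRules tick

end ProcCalc

end

open ProcCalc

namespace ProcCalc

open scoped ENNReal

universe u v w x

/-! The bisimilarity metric is the least fixed point of a functional `bisimulationDist` on `[0,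
∞]`-valued distances, and each of the four bounds comes from a recursive inequality `D ≤ c + lam *
D`. Here `D` is the distance of the two composed processes and `c` is the sum of the distances of
their arguments. Since `D ≤ 1` is finite, the inequality can be solved for `D`, which gives the
factor `1 / (1 - lam)`.

Existence rests on two facts. In the PGSOS format every process has finitely many transitions per
label (`imageFinite_model`), so the best answer to a transition is attained. Hence a pseudometric
bounded by `1` is a bisimulation metric exactly when it is a prefixed point of the functional.
Moreover the functional is monotone and shrinks a uniform error by the factor `lam`
(`bisimulationDist_le_add`), so the iterates from `0` approach their supremum geometrically. This
makes the supremum a fixed point (`bisimulationDist_limitDist`) with no continuity property of the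
Kantorovich lifting; the triangle inequality of the iterates comes from gluing couplings
(`transportCost_triangle`).

For the recursive inequality, a move of `s^ω` leads to `μ ; δ(s^ω)`. Sequential composition is
non-expansive (`limitDist_seq_le`), so comparing with `μ' ; δ(t^ω)` costs at most the distance of
`μ` and `μ'` plus that of `s^ω` and `t^ω`, both discounted by `lam`. The first part is bounded by
the distance of `s` and `t`, the second is `lam * D`. The Kleene stars work the same way, with the
moves of the second argument bounded by its own distance. For bang, asynchronous parallel
composition takes the place of sequential composition (`limitDist_async_le`).

Couplings are handled through infima in `[0, ∞]`, so no optimal coupling is needed, and the infimum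
over an empty set of answers is `∞`. -/

/-! ### Means of nonnegative functions -/

/-- The mean of a nonnegative function with respect to a discrete distribution. -/
noncomputable def mean {α : Type u} (p : PMF α) (g : α → ℝ≥0∞) : ℝ≥0∞ := ∑' a, p a * g a

theorem mean_mono {α : Type u} (p : PMF α) {g h : α → ℝ≥0∞} (hgh : ∀ a, g a ≤ h a) :
    mean p g ≤ mean p h :=
  ENNReal.tsum_le_tsum fun a => mul_le_mul_right (hgh a) (p a)

theorem mean_add {α : Type u} (p : PMF α) (g h : α → ℝ≥0∞) :
    mean p (fun a => g a + h a) = mean p g + mean p h := by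
  simp only [mean, mul_add, ENNReal.tsum_add]

theorem mean_const {α : Type u} (p : PMF α) (c : ℝ≥0∞) : mean p (fun _ => c) = c := by
  rw [mean, ENNReal.tsum_mul_right, p.tsum_coe, one_mul]

theorem mean_pure {α : Type u} (a : α) (g : α → ℝ≥0∞) : mean (PMF.pure a) g = g a := by
  classical
  rw [mean, tsum_eq_single a]
  · simp
  · intro b hb
    simp [hb]

theorem mean_bind {α : Type u} {β : Type v} (p : PMF α) (k : α → PMF β) (g : β → ℝ≥0∞) :
    mean (p.bind k) g = mean p fun a => mean (k a) g := by
  simp only [mean, PMF.bind_apply, ← ENNReal.tsum_mul_right, ← ENNReal.tsum_mul_left, mul_assoc]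
  exact ENNReal.tsum_comm

theorem mean_map {α : Type u} {β : Type v} (p : PMF α) (f : α → β) (g : β → ℝ≥0∞) :
    mean (p.map f) g = mean p fun a => g (f a) := by
  simp only [PMF.map, mean_bind, Function.comp_apply, mean_pure]

/-! ### Couplings -/

/-- Every distribution on a product is a mixture of its conditional distributions. -/
theorem exists_disintegration {α : Type u} {β : Type v} (ω : PMF (α × β)) :
    ∃ k : α → PMF β, ω = (ω.map Prod.fst).bind fun a => (k a).map (Prod.mk a) := by
  classical
  have hfst : ∀ a, (ω.map Prod.fst) a = ∑' b, ω (a, b) := by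
    intro a
    rw [PMF.map_apply, ENNReal.tsum_prod', tsum_eq_single a]
    · simp
    · intro a' ha
      simp [Ne.symm ha]
  have hne : Nonempty β := ⟨ω.support_nonempty.some.2⟩
  have hcond : ∀ a, ∃ k : PMF β, ∀ b, ω (a, b) = (ω.map Prod.fst) a * k b := by
    intro a
    by_cases h0 : (ω.map Prod.fst) a = 0
    -- Over a point of marginal mass zero the conditional distribution is irrelevant, so any value
    -- serves.
    · refine ⟨PMF.pure hne.some, fun b => ?_⟩
      rw [h0, zero_mul]
      rw [hfst, ENNReal.tsum_eq_zero] at h0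
      exact h0 b
    · have htop : (∑' b, ω (a, b)) ≠ ∞ := by
        rw [← hfst]
        exact PMF.apply_ne_top _ _
      refine ⟨PMF.normalize (fun b => ω (a, b)) (by rwa [← hfst]) htop, fun b => ?_⟩
      rw [PMF.normalize_apply, ← hfst, mul_comm (ω (a, b)), ← mul_assoc,
        ENNReal.mul_inv_cancel h0 (PMF.apply_ne_top _ _), one_mul]
  choose k hk using hcond
  refine ⟨k, PMF.ext fun ⟨a, b⟩ => ?_⟩
  rw [PMF.bind_apply, tsum_eq_single a]
  · rw [PMF.map_apply (Prod.mk a), tsum_eq_single b]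
    · simpa using hk a b
    · intro b' hb
      rw [if_neg]
      simpa using Ne.symm hb
  · intro a' ha
    rw [PMF.map_apply (Prod.mk a'), ENNReal.tsum_eq_zero.2, mul_zero]
    intro b'
    rw [if_neg]
    intro h
    exact ha (congrArg Prod.fst h).symm

theorem map_prodMk_mem_matchings {I : Type u} {T : Type w} (p : PMF I) (f g : I → T) :
    p.map (fun i => (f i, g i)) ∈ matchings (p.map f) (p.map g) := by
  constructor <;> rw [PMF.map_comp] <;> rfl

theorem bind_mem_matchings {I : Type u} {T : Type w} (p : PMF I) {f g : I → PMF T}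
    {ω : I → PMF (T × T)} (h : ∀ i, ω i ∈ matchings (f i) (g i)) :
    p.bind ω ∈ matchings (p.bind f) (p.bind g) := by
  constructor
  · rw [PMF.map_bind]
    exact congrArg p.bind (funext fun i => (h i).1)
  · rw [PMF.map_bind]
    exact congrArg p.bind (funext fun i => (h i).2)

theorem map_swap_mem_matchings {T : Type w} {π π' : PMF T} {ω : PMF (T × T)}
    (h : ω ∈ matchings π π') : ω.map Prod.swap ∈ matchings π' π := by
  constructor
  · rw [PMF.map_comp]
    exact h.2
  · rw [PMF.map_comp]
    exact h.1

/-- The independent coupling is a witness. -/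
theorem matchings_nonempty {T : Type w} (π π' : PMF T) : (matchings π π').Nonempty := by
  refine ⟨π.bind fun a => π'.map (Prod.mk a), ?_, ?_⟩
  · simp only [PMF.map_bind, PMF.map_comp]
    exact (congrArg π.bind (funext fun a => PMF.map_const π' a)).trans (PMF.bind_pure π)
  · simp only [PMF.map_bind, PMF.map_comp]
    exact (congrArg π.bind (funext fun _ => PMF.map_id π')).trans (PMF.bind_const π π')

/-! ### The optimal transport cost -/

/-- The Kantorovich lifting of a cost with values in `[0, ∞]`. -/
noncomputable def transportCost {T : Type w} (e : T → T → ℝ≥0∞) (π π' : PMF T) : ℝ≥0∞ :=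
  sInf ((fun ω : PMF (T × T) => mean ω fun q => e q.1 q.2) '' matchings π π')

section TransportCost

variable {T : Type w} {e : T → T → ℝ≥0∞}

theorem transportCost_le {π π' : PMF T} {ω : PMF (T × T)} (hω : ω ∈ matchings π π') :
    transportCost e π π' ≤ mean ω fun q => e q.1 q.2 :=
  sInf_le ⟨ω, hω, rfl⟩

theorem le_transportCost {π π' : PMF T} {c : ℝ≥0∞}
    (h : ∀ ω ∈ matchings π π', c ≤ mean ω fun q => e q.1 q.2) : c ≤ transportCost e π π' :=
  le_sInf (by rintro _ ⟨ω, hω, rfl⟩; exact h ω hω)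

theorem exists_matching_lt {π π' : PMF T} {c : ℝ≥0∞} (h : transportCost e π π' < c) :
    ∃ ω ∈ matchings π π', (mean ω fun q => e q.1 q.2) < c := by
  obtain ⟨_, ⟨ω, hω, rfl⟩, hc⟩ := sInf_lt_iff.1 h
  exact ⟨ω, hω, hc⟩

theorem transportCost_mono {e' : T → T → ℝ≥0∞} {c : ℝ≥0∞} (h : ∀ s t, e s t ≤ e' s t + c)
    (π π' : PMF T) : transportCost e π π' ≤ transportCost e' π π' + c := by
  rw [transportCost, transportCost, ENNReal.sInf_add]
  refine le_iInf₂ ?_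
  rintro _ ⟨ω, hω, rfl⟩
  refine (transportCost_le hω).trans ((mean_mono ω fun q => h q.1 q.2).trans ?_)
  rw [mean_add, mean_const]

/-- A coupling can be pushed forward along `g × h`. In the application `g` and `h` are operators
with one argument frozen, and `c` is the distance of the frozen arguments. -/
theorem transportCost_map_le {g h : T → T} {c : ℝ≥0∞} (hc : ∀ s t, e (g s) (h t) ≤ e s t + c)
    (π π' : PMF T) : transportCost e (π.map g) (π'.map h) ≤ transportCost e π π' + c := by
  conv_rhs => rw [transportCost, ENNReal.sInf_add]
  refine le_iInf₂ ?_
  rintro _ ⟨ω, ⟨rfl, rfl⟩, rfl⟩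
  have hω := map_prodMk_mem_matchings ω (fun q => g q.1) (fun q => h q.2)
  rw [PMF.map_comp, PMF.map_comp]
  refine (transportCost_le hω).trans ?_
  rw [mean_map]
  refine (mean_mono ω fun q => hc q.1 q.2).trans ?_
  rw [mean_add, mean_const]

theorem transportCost_bind_le {I : Type u} (p : PMF I) {f g : I → PMF T} {c : ℝ≥0∞}
    (h : ∀ i, transportCost e (f i) (g i) ≤ c) :
    transportCost e (p.bind f) (p.bind g) ≤ c := by
  -- Optimal couplings need not be available, so couplings of cost below an arbitrary `c' > c` are
  -- mixed.
  refine le_of_forall_gt_imp_ge_of_dense fun c' hc' => ?_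
  choose ω hω hcost using fun i => exists_matching_lt ((h i).trans_lt hc')
  refine (transportCost_le (bind_mem_matchings p hω)).trans ?_
  rw [mean_bind]
  exact (mean_mono p fun i => (hcost i).le).trans (mean_const p c').le

theorem transportCost_self (h : ∀ t, e t t = 0) (π : PMF T) : transportCost e π π = 0 := by
  have hω := map_prodMk_mem_matchings π id id
  rw [PMF.map_id] at hω
  refine le_antisymm ((transportCost_le hω).trans ?_) bot_le
  rw [mean_map]
  simp [h, mean_const]

theorem transportCost_comm (h : ∀ s t, e s t = e t s) (π π' : PMF T) :
    transportCost e π π' = transportCost e π' π := by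
  have key : ∀ π π' : PMF T, transportCost e π π' ≤ transportCost e π' π := by
    intro π π'
    refine le_transportCost fun ω hω => ?_
    refine (transportCost_le (map_swap_mem_matchings hω)).trans ?_
    rw [mean_map]
    exact mean_mono ω fun q => (h q.2 q.1).le
  exact le_antisymm (key _ _) (key _ _)

/-- Gluing: two couplings that share the marginal `ν` are disintegrated over it and recombined
conditionally independently. Taking the first one in `matchings ν π` lets both be disintegrated
along the first coordinate. -/
theorem transportCost_triangle (hcomm : ∀ s t, e s t = e t s)
    (h : ∀ s u t, e s t ≤ e s u + e u t) (π ν π' : PMF T) :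
    transportCost e π π' ≤ transportCost e π ν + transportCost e ν π' := by
  have glue : ∀ ω₁ ∈ matchings ν π, ∀ ω₂ ∈ matchings ν π', transportCost e π π' ≤
      (mean ω₁ fun q => e q.1 q.2) + mean ω₂ fun q => e q.1 q.2 := by
    rintro ω₁ ⟨h₁, h₁'⟩ ω₂ ⟨h₂, h₂'⟩
    obtain ⟨k₁, hk₁⟩ := exists_disintegration ω₁
    obtain ⟨k₂, hk₂⟩ := exists_disintegration ω₂
    rw [h₁] at hk₁
    rw [h₂] at hk₂
    have hπ : ν.bind k₁ = π := by
      rw [← h₁', hk₁, PMF.map_bind]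
      refine congrArg ν.bind (funext fun a => ?_)
      rw [PMF.map_comp]
      exact (PMF.map_id _).symm
    have hπ' : ν.bind k₂ = π' := by
      rw [← h₂', hk₂, PMF.map_bind]
      refine congrArg ν.bind (funext fun a => ?_)
      rw [PMF.map_comp]
      exact (PMF.map_id _).symm
    have hω : (ν.bind fun u => (k₁ u).bind fun s => (k₂ u).map (Prod.mk s)) ∈
        matchings (ν.bind k₁) (ν.bind k₂) := by
      refine bind_mem_matchings ν fun u => ⟨?_, ?_⟩
      · simp only [PMF.map_bind, PMF.map_comp]
        exact (congrArg (k₁ u).bind (funext fun a => PMF.map_const (k₂ u) a)).trans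
          (PMF.bind_pure _)
      · simp only [PMF.map_bind, PMF.map_comp]
        exact (congrArg (k₁ u).bind (funext fun _ => PMF.map_id (k₂ u))).trans
          (PMF.bind_const _ _)
    rw [hπ, hπ'] at hω
    refine (transportCost_le hω).trans ?_
    rw [hk₁, hk₂]
    simp only [mean_bind, mean_map]
    rw [← mean_add]
    refine mean_mono ν fun u => ?_
    calc (mean (k₁ u) fun s => mean (k₂ u) fun t => e s t)
        ≤ mean (k₁ u) fun s => mean (k₂ u) fun t => e u s + e u t :=
          mean_mono _ fun s => mean_mono _ fun t => hcomm u s ▸ h s u t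
      _ = _ := by simp only [mean_add, mean_const]
  rw [transportCost_comm hcomm π ν]
  conv_rhs => rw [transportCost, ENNReal.sInf_add]
  refine le_iInf₂ ?_
  rintro _ ⟨ω₁, hω₁, rfl⟩
  rw [add_comm]
  conv_rhs => rw [transportCost, ENNReal.sInf_add]
  refine le_iInf₂ ?_
  rintro _ ⟨ω₂, hω₂, rfl⟩
  rw [add_comm]
  exact glue ω₁ hω₁ ω₂ hω₂

end TransportCost

/-- Boundedness by `1` keeps every coupling cost finite, so passing to the reals commutes with the
infimum and with the series. -/
theorem toReal_transportCost {T : Type w} {d : T → T → ℝ} (h0 : ∀ s t, 0 ≤ d s t)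
    (h1 : ∀ s t, d s t ≤ 1) (π π' : PMF T) :
    (transportCost (fun s t => ENNReal.ofReal (d s t)) π π').toReal = kantorovich d π π' := by
  have hle : ∀ ω : PMF (T × T), (mean ω fun q => ENNReal.ofReal (d q.1 q.2)) ≤ 1 := by
    intro ω
    refine (mean_mono ω fun q => ?_).trans (mean_const ω 1).le
    simpa using h1 q.1 q.2
  rw [transportCost, ENNReal.toReal_sInf, Set.image_image, kantorovich]
  · congr 1
    refine Set.image_congr fun ω _ => ?_
    rw [mean, ENNReal.tsum_toReal_eq]
    · refine tsum_congr fun q => ?_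
      rw [ENNReal.toReal_mul, ENNReal.toReal_ofReal (h0 _ _), mul_comm]
    · exact fun q => ENNReal.mul_ne_top (PMF.apply_ne_top _ _) ENNReal.ofReal_ne_top
  · rintro _ ⟨ω, -, rfl⟩
    exact ((hle ω).trans_lt ENNReal.one_lt_top).ne

theorem transportCost_le_one {T : Type w} {e : T → T → ℝ≥0∞} (h1 : ∀ s t, e s t ≤ 1)
    (π π' : PMF T) : transportCost e π π' ≤ 1 := by
  obtain ⟨ω, hω⟩ := matchings_nonempty π π'
  exact (transportCost_le hω).trans ((mean_mono ω fun q => h1 q.1 q.2).trans (mean_const ω 1).le)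

/-! ### The bisimulation functional -/

section Functional

variable {S : Signature.{v}} {A : Type u}

/-- How badly `t` simulates the transitions of `s`, where target distributions are compared by the
`l`-discounted lifting of `e`. -/
noncomputable def simulationDist (M : PTS S A) (l : ℝ≥0∞) (e : Proc S → Proc S → ℝ≥0∞)
    (s t : Proc S) : ℝ≥0∞ :=
  ⨆ (a : A) (π : PMF (Proc S)) (_ : M s a π),
    min 1 (⨅ (π' : PMF (Proc S)) (_ : M t a π'), l * transportCost e π π')

/-- The bisimulation functional. -/
noncomputable def bisimulationDist (M : PTS S A) (l : ℝ≥0∞) (e : Proc S → Proc S → ℝ≥0∞)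
    (s t : Proc S) : ℝ≥0∞ :=
  max (simulationDist M l e s t) (simulationDist M l e t s)

/-- Finitely many transitions for every process and label. -/
def ImageFinite (M : PTS S A) : Prop := ∀ t a, {π | M t a π}.Finite

variable {M : PTS S A} {l : ℝ≥0∞} {e e' : Proc S → Proc S → ℝ≥0∞}

/-- The truncation at `1` makes every bound `c ≥ 1` free. Answers are therefore needed only when `c
< 1`, which later guarantees that the arguments are at distance below `1` as well. -/
theorem simulationDist_le {s t : Proc S} {c : ℝ≥0∞}
    (h : c < 1 → ∀ a π, M s a π → ∃ π', M t a π' ∧ l * transportCost e π π' ≤ c) :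
    simulationDist M l e s t ≤ c := by
  refine iSup_le fun a => iSup₂_le fun π hπ => ?_
  rcases lt_or_ge c 1 with hc | hc
  · obtain ⟨π', hπ', hle⟩ := h hc a π hπ
    exact (min_le_right _ _).trans ((iInf₂_le π' hπ').trans hle)
  · exact (min_le_left _ _).trans hc

/-- A distance below `1` rules out the empty infimum, so some answer exists; by image-finiteness a
best one does. -/
theorem exists_of_simulationDist_lt_one (hM : ImageFinite M) {s t : Proc S}
    (h : simulationDist M l e s t < 1) {a : A} {π : PMF (Proc S)} (hπ : M s a π) :
    ∃ π', M t a π' ∧ l * transportCost e π π' ≤ simulationDist M l e s t := by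
  have hle : min 1 (⨅ (π' : PMF (Proc S)) (_ : M t a π'), l * transportCost e π π') ≤
      simulationDist M l e s t :=
    le_iSup_of_le a (le_iSup₂_of_le π hπ le_rfl)
  have hlt := (min_lt_iff.1 (hle.trans_lt h)).resolve_left (lt_irrefl _)
  rw [min_eq_right hlt.le] at hle
  obtain ⟨π₀, hπ₀⟩ := iInf_lt_iff.1 hlt
  obtain ⟨hπ₀, -⟩ := iInf_lt_iff.1 hπ₀
  obtain ⟨π', hπ', hmin⟩ :=
    Set.exists_min_image _ (fun π' => l * transportCost e π π') (hM t a) ⟨π₀, hπ₀⟩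
  exact ⟨π', hπ', (le_iInf₂ hmin).trans hle⟩

theorem bisimulationDist_comm (s t : Proc S) :
    bisimulationDist M l e s t = bisimulationDist M l e t s := max_comm _ _

theorem bisimulationDist_le {s t : Proc S} {c : ℝ≥0∞}
    (h : c < 1 → ∀ a π, M s a π → ∃ π', M t a π' ∧ l * transportCost e π π' ≤ c)
    (h' : c < 1 → ∀ a π, M t a π → ∃ π', M s a π' ∧ l * transportCost e π π' ≤ c) :
    bisimulationDist M l e s t ≤ c :=
  max_le (simulationDist_le h) (simulationDist_le h')

theorem exists_of_bisimulationDist_lt_one (hM : ImageFinite M) {s t : Proc S}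
    (h : bisimulationDist M l e s t < 1) {a : A} {π : PMF (Proc S)} (hπ : M s a π) :
    ∃ π', M t a π' ∧ l * transportCost e π π' ≤ bisimulationDist M l e s t := by
  obtain ⟨π', hπ', hle⟩ :=
    exists_of_simulationDist_lt_one hM ((le_max_left _ _).trans_lt h) hπ
  exact ⟨π', hπ', hle.trans (le_max_left _ _)⟩

theorem bisimulationDist_le_one (s t : Proc S) : bisimulationDist M l e s t ≤ 1 :=
  bisimulationDist_le (fun h => absurd h (lt_irrefl _)) fun h => absurd h (lt_irrefl _)

theorem bisimulationDist_self (he : ∀ t, e t t = 0) (t : Proc S) :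
    bisimulationDist M l e t t = 0 := by
  have h : ∀ a π, M t a π → ∃ π', M t a π' ∧ l * transportCost e π π' ≤ 0 := fun a π hπ =>
    ⟨π, hπ, by rw [transportCost_self he, mul_zero]⟩
  exact le_antisymm (bisimulationDist_le (fun _ => h) fun _ => h) bot_le

/-- Answers compose: `u` answers `s`, then `t` answers `u`. If the sum is below `1`, so are both
summands, and both answers exist. -/
theorem bisimulationDist_triangle (hM : ImageFinite M) (hcomm : ∀ s t, e s t = e t s)
    (htri : ∀ s u t, e s t ≤ e s u + e u t) (s u t : Proc S) :
    bisimulationDist M l e s t ≤ bisimulationDist M l e s u + bisimulationDist M l e u t := by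
  have key : ∀ s t : Proc S, bisimulationDist M l e s u + bisimulationDist M l e u t < 1 →
      ∀ a π, M s a π → ∃ π', M t a π' ∧ l * transportCost e π π' ≤
        bisimulationDist M l e s u + bisimulationDist M l e u t := by
    intro s t h a π hπ
    obtain ⟨ν, hν, h₁⟩ := exists_of_bisimulationDist_lt_one hM (le_self_add.trans_lt h) hπ
    obtain ⟨π', hπ', h₂⟩ := exists_of_bisimulationDist_lt_one hM (le_add_self.trans_lt h) hν
    refine ⟨π', hπ', le_trans ?_ (add_le_add h₁ h₂)⟩
    rw [← mul_add]
    exact mul_le_mul_right (transportCost_triangle hcomm htri π ν π') l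
  refine bisimulationDist_le (key s t) ?_
  rw [bisimulationDist_comm s u, bisimulationDist_comm u t, add_comm]
  exact key t s

/-- A uniform error `c` passes unchanged through the lifting, because couplings have total mass one,
and is then discounted by `l`. Monotonicity is the case `c = 0`. -/
theorem bisimulationDist_le_add (hM : ImageFinite M) {c : ℝ≥0∞}
    (h : ∀ s t, e s t ≤ e' s t + c) (s t : Proc S) :
    bisimulationDist M l e s t ≤ bisimulationDist M l e' s t + l * c := by
  have key : ∀ s t : Proc S, bisimulationDist M l e' s t + l * c < 1 →
      ∀ a π, M s a π → ∃ π', M t a π' ∧ l * transportCost e π π' ≤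
        bisimulationDist M l e' s t + l * c := by
    intro s t hlt a π hπ
    obtain ⟨π', hπ', hle⟩ := exists_of_bisimulationDist_lt_one hM (le_self_add.trans_lt hlt) hπ
    refine ⟨π', hπ', le_trans ?_ (add_le_add_left hle _)⟩
    rw [← mul_add]
    exact mul_le_mul_right (transportCost_mono h π π') l
  refine bisimulationDist_le (key s t) ?_
  rw [bisimulationDist_comm s t]
  exact key t s

theorem bisimulationDist_mono (hM : ImageFinite M) (h : ∀ s t, e s t ≤ e' s t) (s t : Proc S) :
    bisimulationDist M l e s t ≤ bisimulationDist M l e' s t := by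
  simpa using bisimulationDist_le_add (l := l) (c := 0) hM (fun s t => by simpa using h s t) s t

/-! ### The least fixed point -/

/-- The finite approximations of the bisimilarity metric. -/
noncomputable def approxDist (M : PTS S A) (l : ℝ≥0∞) : ℕ → Proc S → Proc S → ℝ≥0∞
  | 0 => fun _ _ => 0
  | n + 1 => bisimulationDist M l (approxDist M l n)

/-- The least fixed point of the bisimulation functional. -/
noncomputable def limitDist (M : PTS S A) (l : ℝ≥0∞) (s t : Proc S) : ℝ≥0∞ :=
  ⨆ n, approxDist M l n s t

theorem approxDist_le_one (n : ℕ) (s t : Proc S) : approxDist M l n s t ≤ 1 := by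
  cases n with
  | zero => exact zero_le_one
  | succ n => exact bisimulationDist_le_one s t

theorem approxDist_self (n : ℕ) (t : Proc S) : approxDist M l n t t = 0 := by
  induction n generalizing t with
  | zero => rfl
  | succ n ih => exact bisimulationDist_self ih t

theorem approxDist_comm (n : ℕ) (s t : Proc S) : approxDist M l n s t = approxDist M l n t s := by
  cases n with
  | zero => rfl
  | succ n => exact bisimulationDist_comm s t

theorem approxDist_triangle (hM : ImageFinite M) (n : ℕ) (s u t : Proc S) :
    approxDist M l n s t ≤ approxDist M l n s u + approxDist M l n u t := by
  induction n generalizing s u t with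
  | zero => exact bot_le
  | succ n ih => exact bisimulationDist_triangle hM (approxDist_comm n) ih s u t

theorem approxDist_le_succ (hM : ImageFinite M) (n : ℕ) (s t : Proc S) :
    approxDist M l n s t ≤ approxDist M l (n + 1) s t := by
  induction n generalizing s t with
  | zero => exact bot_le
  | succ n ih => exact bisimulationDist_mono hM ih s t

theorem approxDist_monotone (hM : ImageFinite M) (s t : Proc S) :
    Monotone fun n => approxDist M l n s t :=
  monotone_nat_of_le_succ fun n => approxDist_le_succ hM n s t

/-- Any iterate is within `1 = l ^ 0` of the initial zero distance, and each application of the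
functional multiplies this error by `l`. -/
theorem approxDist_add_le (hM : ImageFinite M) (n k : ℕ) (s t : Proc S) :
    approxDist M l (n + k) s t ≤ approxDist M l n s t + l ^ n := by
  induction n generalizing s t with
  | zero => simpa [approxDist] using approxDist_le_one (M := M) (l := l) k s t
  | succ n ih =>
    rw [Nat.add_right_comm, pow_succ']
    exact bisimulationDist_le_add hM ih s t

theorem approxDist_le_limitDist (n : ℕ) (s t : Proc S) :
    approxDist M l n s t ≤ limitDist M l s t :=
  le_iSup (fun n => approxDist M l n s t) n

theorem limitDist_le_approxDist_add (hM : ImageFinite M) (n : ℕ) (s t : Proc S) :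
    limitDist M l s t ≤ approxDist M l n s t + l ^ n := by
  refine iSup_le fun k => ?_
  refine le_trans ?_ (approxDist_add_le hM n k s t)
  exact approxDist_monotone hM s t (Nat.le_add_left k n)

theorem limitDist_le_one (s t : Proc S) : limitDist M l s t ≤ 1 :=
  iSup_le fun n => approxDist_le_one n s t

theorem limitDist_ne_top (s t : Proc S) : limitDist M l s t ≠ ∞ :=
  ((limitDist_le_one s t).trans_lt ENNReal.one_lt_top).ne

theorem limitDist_self (t : Proc S) : limitDist M l t t = 0 := by
  simp [limitDist, approxDist_self]

theorem limitDist_comm (s t : Proc S) : limitDist M l s t = limitDist M l t s :=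
  iSup_congr fun n => approxDist_comm n s t

theorem limitDist_triangle (hM : ImageFinite M) (s u t : Proc S) :
    limitDist M l s t ≤ limitDist M l s u + limitDist M l u t :=
  iSup_le fun n => (approxDist_triangle hM n s u t).trans
    (add_le_add (approxDist_le_limitDist n s u) (approxDist_le_limitDist n u t))

/-- For `≤`, the limit exceeds the `n`-th iterate by at most `l ^ n`, so its image exceeds the next
iterate by at most `l * l ^ n`, which tends to zero. The converse is monotonicity. -/
theorem bisimulationDist_limitDist (hM : ImageFinite M) (hl : l < 1) :
    bisimulationDist M l (limitDist M l) = limitDist M l := by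
  funext s t
  apply le_antisymm
  · have htend : Filter.Tendsto (fun n : ℕ => limitDist M l s t + l * l ^ n) Filter.atTop
        (nhds (limitDist M l s t + l * 0)) :=
      tendsto_const_nhds.add (ENNReal.Tendsto.const_mul
        (ENNReal.tendsto_pow_atTop_nhds_zero_of_lt_one hl) (Or.inr (hl.trans ENNReal.one_lt_top).ne))
    rw [mul_zero, add_zero] at htend
    refine ge_of_tendsto' htend fun n => ?_
    refine (bisimulationDist_le_add hM (limitDist_le_approxDist_add hM n) s t).trans ?_
    exact add_le_add_left (approxDist_le_limitDist (n + 1) s t) _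
  · refine iSup_le fun n => (approxDist_le_succ hM n s t).trans ?_
    exact bisimulationDist_mono hM (approxDist_le_limitDist n) s t

theorem limitDist_le_of_bisimulationDist_le (hM : ImageFinite M)
    (he : ∀ s t, bisimulationDist M l e s t ≤ e s t) (s t : Proc S) : limitDist M l s t ≤ e s t := by
  refine iSup_le fun n => ?_
  induction n generalizing s t with
  | zero => exact bot_le
  | succ n ih => exact (bisimulationDist_mono hM ih s t).trans (he s t)

end Functional

/-! ### The bisimilarity metric as a least fixed point -/

section Metric

variable {S : Signature.{v}} {A : Type u} {M : PTS S A} {lam : ℝ}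

/-- Every bisimulation metric is a prefixed point, and thus lies above all iterates. -/
theorem bisimulationDist_le_of_isBisimulationMetric (hlam : 0 ≤ lam)
    {d : Proc S → Proc S → ℝ} (hd : IsBisimulationMetric M lam d) (s t : Proc S) :
    bisimulationDist M (ENNReal.ofReal lam) (fun s t => ENNReal.ofReal (d s t)) s t ≤
      ENNReal.ofReal (d s t) := by
  obtain ⟨hp, hd⟩ := hd
  have key : ∀ s t, ENNReal.ofReal (d s t) < 1 → ∀ a π, M s a π → ∃ π', M t a π' ∧
      ENNReal.ofReal lam * transportCost (fun s t => ENNReal.ofReal (d s t)) π π' ≤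
        ENNReal.ofReal (d s t) := by
    intro s t h a π hπ
    obtain ⟨π', hπ', hle⟩ := hd s t (ENNReal.ofReal_lt_one.1 h) a π hπ
    refine ⟨π', hπ', ?_⟩
    have hfin : transportCost (fun s t => ENNReal.ofReal (d s t)) π π' ≠ ∞ :=
      ((transportCost_le_one (fun s t => by simpa using hp.le_one s t) π π').trans_lt
        ENNReal.one_lt_top).ne
    rw [← ENNReal.ofReal_toReal hfin, ← ENNReal.ofReal_mul hlam,
      toReal_transportCost hp.nonneg hp.le_one]
    exact ENNReal.ofReal_le_ofReal hle
  refine bisimulationDist_le (key s t) ?_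
  rw [hp.symm s t]
  exact key t s

theorem isBisimulationMetric_limitDist (hM : ImageFinite M) (hlam₀ : 0 ≤ lam) (hlam₁ : lam < 1) :
    IsBisimulationMetric M lam fun s t => (limitDist M (ENNReal.ofReal lam) s t).toReal := by
  set l := ENNReal.ofReal lam
  have hl : l < 1 := ENNReal.ofReal_lt_one.2 hlam₁
  have h1 : ∀ s t, (limitDist M l s t).toReal ≤ 1 := fun s t =>
    ENNReal.toReal_le_of_le_ofReal zero_le_one (by simpa using limitDist_le_one s t)
  refine ⟨⟨fun _ _ => ENNReal.toReal_nonneg, h1, fun t => by simp [limitDist_self],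
    fun s t => by rw [limitDist_comm], fun s t u => ?_⟩, fun s t h a π hπ => ?_⟩
  · rw [← ENNReal.toReal_add (limitDist_ne_top _ _) (limitDist_ne_top _ _)]
    exact ENNReal.toReal_mono (ENNReal.add_ne_top.2 ⟨limitDist_ne_top _ _, limitDist_ne_top _ _⟩)
      (limitDist_triangle hM s u t)
  · have hlt : bisimulationDist M l (limitDist M l) s t < 1 := by
      rw [bisimulationDist_limitDist hM hl, ← ENNReal.ofReal_toReal (limitDist_ne_top s t)]
      exact ENNReal.ofReal_lt_one.2 h
    obtain ⟨π', hπ', hle⟩ := exists_of_bisimulationDist_lt_one hM hlt hπ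
    refine ⟨π', hπ', ?_⟩
    rw [bisimulationDist_limitDist hM hl] at hle
    have h := ENNReal.toReal_mono (limitDist_ne_top s t) hle
    rw [ENNReal.toReal_mul, ENNReal.toReal_ofReal hlam₀] at h
    rw [← toReal_transportCost (fun _ _ => ENNReal.toReal_nonneg) h1]
    simpa only [ENNReal.ofReal_toReal (limitDist_ne_top _ _)] using h

theorem toReal_limitDist_le (hM : ImageFinite M) (hlam₀ : 0 ≤ lam)
    {d : Proc S → Proc S → ℝ} (hd : IsBisimulationMetric M lam d) (s t : Proc S) :
    (limitDist M (ENNReal.ofReal lam) s t).toReal ≤ d s t :=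
  ENNReal.toReal_le_of_le_ofReal (hd.1.nonneg s t) (limitDist_le_of_bisimulationDist_le hM
    (bisimulationDist_le_of_isBisimulationMetric hlam₀ hd) s t)

theorem bisimilarityMetric_eq (hM : ImageFinite M) (hlam₀ : 0 ≤ lam) (hlam₁ : lam < 1)
    (s t : Proc S) :
    bisimilarityMetric M lam s t = (limitDist M (ENNReal.ofReal lam) s t).toReal := by
  refine IsLeast.csInf_eq ⟨⟨_, isBisimulationMetric_limitDist hM hlam₀ hlam₁, rfl⟩, ?_⟩
  rintro _ ⟨d, hd, rfl⟩
  exact toReal_limitDist_le hM hlam₀ hd s t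

theorem isLeast_bisimilarityMetric (hM : ImageFinite M) (hlam₀ : 0 ≤ lam) (hlam₁ : lam < 1) :
    IsLeast {d | IsBisimulationMetric M lam d} (bisimilarityMetric M lam) := by
  have h : bisimilarityMetric M lam =
      fun s t => (limitDist M (ENNReal.ofReal lam) s t).toReal :=
    funext₂ (bisimilarityMetric_eq hM hlam₀ hlam₁)
  rw [h]
  exact ⟨isBisimulationMetric_limitDist hM hlam₀ hlam₁,
    fun d hd s t => toReal_limitDist_le hM hlam₀ hd s t⟩

end Metric

/-! ### Image-finiteness of PGSOS specifications -/

/-- Structural induction: finitely many rules apply, each has finitely many positive premises with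
finitely many solutions, and the target is a function of these solutions. Negative premises only
remove transitions. -/
theorem imageFinite_model {S : Signature.{v}} {A : Type u} (P : PTSS S A) :
    ImageFinite P.model := by
  intro t
  induction t with
  | var x => exact x.elim
  | op f ts ih =>
    intro a
    have hfin : (⋃ r ∈ P.rules f a, (fun ρ => r.target.eval ts ρ) ''
        Set.pi Set.univ fun k => {π | P.model (ts (r.pos k).1) (r.pos k).2 π}).Finite :=
      (P.finite_rules f a).biUnion fun r _ =>
        (Set.Finite.pi fun k => ih (r.pos k).1 (r.pos k).2).image _
    refine hfin.subset fun π hπ => ?_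
    simp only [Set.mem_ofPred_eq, PTSS.model] at hπ
    obtain ⟨r, hr, ρ, hp, -, rfl⟩ := hπ
    exact Set.mem_biUnion hr ⟨ρ, fun k _ => hp k, rfl⟩

/-! ### Evaluation of distribution terms -/

theorem piPMF_two {α : Type w} (π : Fin 2 → PMF α) :
    piPMF π = (π 0).bind fun x => (π 1).map fun y => ![x, y] := by
  simp only [piPMF, PMF.map_bind, PMF.pure_map]
  rfl

section Eval

variable {A : Type u} {S : Signature.{v}} (ι : ∀ n, PAOp A n → S n) {V : Type w} {D : Type x}
  (σ : V → Proc S) (ρ : D → PMF (Proc S))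

theorem eval_d2 (f : PAOp A 2) (θ₁ θ₂ : DTerm (PAOp A) V D) :
    ((d2 f θ₁ θ₂).mapSig ι).eval σ ρ = ((θ₁.mapSig ι).eval σ ρ).bind fun x =>
      ((θ₂.mapSig ι).eval σ ρ).map fun y => Term.op (ι 2 f) ![x, y] := by
  simp only [d2, DTerm.mapSig, DTerm.eval, piPMF_two, PMF.map_bind, PMF.map_comp]
  rfl

theorem eval_d2_dirac_right (f : PAOp A 2) (θ : DTerm (PAOp A) V D) (t : Term (PAOp A) V) :
    ((d2 f θ (.dirac t)).mapSig ι).eval σ ρ =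
      ((θ.mapSig ι).eval σ ρ).map fun x => Term.op (ι 2 f) ![x, (t.mapSig ι).subst σ] := by
  rw [eval_d2]
  simp only [DTerm.mapSig, DTerm.eval, PMF.pure_map]
  rfl

theorem eval_d2_dirac_left (f : PAOp A 2) (θ : DTerm (PAOp A) V D) (t : Term (PAOp A) V) :
    ((d2 f (.dirac t) θ).mapSig ι).eval σ ρ =
      ((θ.mapSig ι).eval σ ρ).map fun x => Term.op (ι 2 f) ![(t.mapSig ι).subst σ, x] := by
  rw [eval_d2]
  simp only [DTerm.mapSig, DTerm.eval, PMF.pure_bind]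

theorem subst_op_one (f : PAOp A 1) (i : V) :
    ((Term.op f ![.var i] : Term (PAOp A) V).mapSig ι).subst σ = .op (ι 1 f) ![σ i] := by
  simp only [Term.mapSig, Term.subst]
  congr 1
  funext k
  fin_cases k
  rfl

theorem subst_op_two (f : PAOp A 2) (i j : V) :
    ((Term.op f ![.var i, .var j] : Term (PAOp A) V).mapSig ι).subst σ =
      .op (ι 2 f) ![σ i, σ j] := by
  simp only [Term.mapSig, Term.subst]
  congr 1
  funext k
  fin_cases k <;> rfl

theorem eval_dMix (p : Set.Ioo (0 : ℝ) 1) (θ₁ θ₂ : DTerm (PAOp A) V D) :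
    ((dMix p θ₁ θ₂).mapSig ι).eval σ ρ = (coin p).bind fun b =>
      bif b then (θ₁.mapSig ι).eval σ ρ else (θ₂.mapSig ι).eval σ ρ := by
  simp only [dMix, DTerm.mapSig, DTerm.eval]
  congr 1
  funext b
  cases b <;> rfl

end Eval

/-! ### The transitions of the operators -/

section Transitions

variable {A : Type u} {tick : A} {S : Signature.{v}} {P : PTSS S A} {ι : ∀ n, PAOp A n → S n}

/-- This is where disjointness of the extension enters: no foreign rule can add a transition to an
operator of the process algebra. -/
theorem model_op_iff (hP : IsDisjointExtension ι (paSpec tick) P) {n : ℕ} (f : PAOp A n)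
    (ts : Fin n → Proc S) (a : A) (π : PMF (Proc S)) :
    P.model (.op (ι n f) ts) a π ↔ ∃ r ∈ paRules tick f a, ∃ ρ : Fin r.numPos → PMF (Proc S),
      (∀ k, P.model (ts (r.pos k).1) (r.pos k).2 (ρ k)) ∧
      (∀ q ∈ r.neg, ∀ π', ¬ P.model (ts q.1) q.2 π') ∧
      π = (r.target.mapSig ι).eval ts ρ := by
  simp only [PTSS.model, hP.rules_eq, Set.exists_mem_image]
  rfl

theorem model_seq_iff (hP : IsDisjointExtension ι (paSpec tick) P) (x y : Proc S) (a : A)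
    (π : PMF (Proc S)) :
    P.model (.op (ι 2 .seq) ![x, y]) a π ↔
      (a ≠ tick ∧ ∃ μ, P.model x a μ ∧ π = μ.map fun z => .op (ι 2 .seq) ![z, y]) ∨
      ((∃ μ, P.model x tick μ) ∧ P.model y a π) := by
  rw [model_op_iff hP]
  constructor
  · rintro ⟨_, ⟨ha, rfl⟩ | rfl, ρ, hp, -, rfl⟩
    · exact Or.inl ⟨ha, ρ 0, hp 0, eval_d2_dirac_right ι _ ρ _ _ _⟩
    · exact Or.inr ⟨⟨ρ 0, hp 0⟩, hp 1⟩
  · rintro (⟨ha, μ, hμ, rfl⟩ | ⟨⟨μ, hμ⟩, hπ⟩)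
    · exact ⟨_, Or.inl ⟨ha, rfl⟩, ![μ], Fin.forall_fin_one.2 hμ, by simp,
        (eval_d2_dirac_right ι ![x, y] ![μ] _ (.var 0) (.var 1)).symm⟩
    · exact ⟨_, Or.inr rfl, ![μ, π], Fin.forall_fin_two.2 ⟨hμ, hπ⟩, by simp, rfl⟩

theorem model_async_iff (hP : IsDisjointExtension ι (paSpec tick) P) (x y : Proc S) (a : A)
    (π : PMF (Proc S)) :
    P.model (.op (ι 2 .async) ![x, y]) a π ↔
      (a ≠ tick ∧ ∃ μ, P.model x a μ ∧ π = μ.map fun z => .op (ι 2 .async) ![z, y]) ∨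
      (a ≠ tick ∧ ∃ ν, P.model y a ν ∧ π = ν.map fun z => .op (ι 2 .async) ![x, z]) ∨
      (a = tick ∧ (∃ μ, P.model x tick μ) ∧ (∃ ν, P.model y tick ν) ∧
        π = PMF.pure (.op (ι 0 .nil) ![])) := by
  have hnil : ∀ (σ : Fin 2 → Proc S) (ρ : Fin 2 → PMF (Proc S)),
      ((dNil : DTerm (PAOp A) _ _).mapSig ι).eval σ ρ = PMF.pure (.op (ι 0 .nil) ![]) := by
    intro σ ρ
    simp only [dNil, DTerm.mapSig, DTerm.eval, Term.mapSig, Term.subst]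
    congr 2
    exact Subsingleton.elim _ _
  rw [model_op_iff hP]
  constructor
  · rintro ⟨_, (⟨ha, rfl⟩ | ⟨ha, rfl⟩) | ⟨ha, rfl⟩, ρ, hp, -, rfl⟩
    · exact Or.inl ⟨ha, ρ 0, hp 0, eval_d2_dirac_right ι _ ρ _ _ _⟩
    · exact Or.inr (Or.inl ⟨ha, ρ 0, hp 0, eval_d2_dirac_left ι _ ρ _ _ _⟩)
    · exact Or.inr (Or.inr ⟨ha, ⟨ρ 0, hp 0⟩, ⟨ρ 1, hp 1⟩, hnil _ ρ⟩)
  · rintro (⟨ha, μ, hμ, rfl⟩ | ⟨ha, ν, hν, rfl⟩ | ⟨ha, ⟨μ, hμ⟩, ⟨ν, hν⟩, rfl⟩)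
    · exact ⟨_, Or.inl (Or.inl ⟨ha, rfl⟩), ![μ], Fin.forall_fin_one.2 hμ, by simp,
        (eval_d2_dirac_right ι ![x, y] ![μ] _ (.var 0) (.var 1)).symm⟩
    · exact ⟨_, Or.inl (Or.inr ⟨ha, rfl⟩), ![ν], Fin.forall_fin_one.2 hν, by simp,
        (eval_d2_dirac_left ι ![x, y] ![ν] _ (.var 0) (.var 0)).symm⟩
    · exact ⟨_, Or.inr ⟨ha, rfl⟩, ![μ, ν], Fin.forall_fin_two.2 ⟨hμ, hν⟩, by simp,
        (hnil _ _).symm⟩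

theorem model_omega_iff (hP : IsDisjointExtension ι (paSpec tick) P) (x : Proc S) (a : A)
    (π : PMF (Proc S)) :
    P.model (.op (ι 1 .omega) ![x]) a π ↔ a ≠ tick ∧ ∃ μ, P.model x a μ ∧
      π = μ.map fun z => .op (ι 2 .seq) ![z, .op (ι 1 .omega) ![x]] := by
  have heval : ∀ ρ : Fin 1 → PMF (Proc S),
      ((d2 .seq (.var 0) (dOp1 .omega 0) : DTerm (PAOp A) (Fin 1) (Fin 1)).mapSig ι).eval ![x] ρ =
        (ρ 0).map fun z => .op (ι 2 .seq) ![z, .op (ι 1 .omega) ![x]] := by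
    intro ρ
    rw [dOp1, eval_d2_dirac_right, subst_op_one]
    rfl
  rw [model_op_iff hP]
  constructor
  · rintro ⟨_, ⟨ha, rfl⟩, ρ, hp, -, rfl⟩
    exact ⟨ha, ρ 0, hp 0, heval ρ⟩
  · rintro ⟨ha, μ, hμ, rfl⟩
    exact ⟨_, ⟨ha, rfl⟩, ![μ], Fin.forall_fin_one.2 hμ, by simp, (heval ![μ]).symm⟩

theorem model_bang_iff (hP : IsDisjointExtension ι (paSpec tick) P) (x : Proc S) (a : A)
    (π : PMF (Proc S)) :
    P.model (.op (ι 1 .bang) ![x]) a π ↔ a ≠ tick ∧ ∃ μ, P.model x a μ ∧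
      π = μ.map fun z => .op (ι 2 .async) ![z, .op (ι 1 .bang) ![x]] := by
  have heval : ∀ ρ : Fin 1 → PMF (Proc S),
      ((d2 .async (.var 0) (dOp1 .bang 0) : DTerm (PAOp A) (Fin 1) (Fin 1)).mapSig ι).eval ![x] ρ =
        (ρ 0).map fun z => .op (ι 2 .async) ![z, .op (ι 1 .bang) ![x]] := by
    intro ρ
    rw [dOp1, eval_d2_dirac_right, subst_op_one]
    rfl
  rw [model_op_iff hP]
  constructor
  · rintro ⟨_, ⟨ha, rfl⟩, ρ, hp, -, rfl⟩
    exact ⟨ha, ρ 0, hp 0, heval ρ⟩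
  · rintro ⟨ha, μ, hμ, rfl⟩
    exact ⟨_, ⟨ha, rfl⟩, ![μ], Fin.forall_fin_one.2 hμ, by simp, (heval ![μ]).symm⟩

theorem eval_seq_dOp2 {m : ℕ} (f : PAOp A 2) (x y : Proc S) (k : Fin m)
    (ρ : Fin m → PMF (Proc S)) :
    ((d2 .seq (.var k) (dOp2 f 0 1) : DTerm (PAOp A) (Fin 2) (Fin m)).mapSig ι).eval ![x, y] ρ =
      (ρ k).map fun z => .op (ι 2 .seq) ![z, .op (ι 2 f) ![x, y]] := by
  rw [dOp2, eval_d2_dirac_right, subst_op_two]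
  rfl

theorem model_star_iff (hP : IsDisjointExtension ι (paSpec tick) P) (x y : Proc S) (a : A)
    (π : PMF (Proc S)) :
    P.model (.op (ι 2 .star) ![x, y]) a π ↔
      (a ≠ tick ∧ ∃ μ, P.model x a μ ∧
        π = μ.map fun z => .op (ι 2 .seq) ![z, .op (ι 2 .star) ![x, y]]) ∨
      P.model y a π := by
  rw [model_op_iff hP]
  constructor
  · rintro ⟨_, ⟨ha, rfl⟩ | rfl, ρ, hp, -, rfl⟩
    · exact Or.inl ⟨ha, ρ 0, hp 0, eval_seq_dOp2 _ x y 0 ρ⟩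
    · exact Or.inr (hp 0)
  · rintro (⟨ha, μ, hμ, rfl⟩ | hπ)
    · exact ⟨_, Or.inl ⟨ha, rfl⟩, ![μ], Fin.forall_fin_one.2 hμ, by simp,
        (eval_seq_dOp2 _ x y 0 ![μ]).symm⟩
    · exact ⟨_, Or.inr rfl, ![π], Fin.forall_fin_one.2 hπ, by simp, rfl⟩

theorem model_starP_iff (hP : IsDisjointExtension ι (paSpec tick) P) (p : Set.Ioo (0 : ℝ) 1)
    (x y : Proc S) (a : A) (π : PMF (Proc S)) :
    P.model (.op (ι 2 (.starP p)) ![x, y]) a π ↔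
      (a ≠ tick ∧ ∃ μ ν, P.model x a μ ∧ P.model y a ν ∧ π = (coin p).bind fun b =>
        bif b then ν else μ.map fun z => .op (ι 2 .seq) ![z, .op (ι 2 (.starP p)) ![x, y]]) ∨
      (a ≠ tick ∧ ∃ μ, P.model x a μ ∧ (∀ ν, ¬ P.model y a ν) ∧
        π = μ.map fun z => .op (ι 2 .seq) ![z, .op (ι 2 (.starP p)) ![x, y]]) ∨
      (a ≠ tick ∧ (∀ μ, ¬ P.model x a μ) ∧ P.model y a π) ∨
      (a = tick ∧ P.model y a π) := by
  have heval : ∀ ρ : Fin 2 → PMF (Proc S),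
      ((dMix p (.var 1) (d2 .seq (.var 0) (dOp2 (.starP p) 0 1)) :
        DTerm (PAOp A) (Fin 2) (Fin 2)).mapSig ι).eval ![x, y] ρ = (coin p).bind fun b =>
          bif b then ρ 1 else
            (ρ 0).map fun z => .op (ι 2 .seq) ![z, .op (ι 2 (.starP p)) ![x, y]] := by
    intro ρ
    rw [eval_dMix, eval_seq_dOp2]
    rfl
  rw [model_op_iff hP]
  constructor
  · rintro ⟨_, ((⟨ha, rfl⟩ | ⟨ha, rfl⟩) | ⟨ha, rfl⟩) | ⟨ha, rfl⟩, ρ, hp, hn, rfl⟩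
    · exact Or.inl ⟨ha, ρ 0, ρ 1, hp 0, hp 1, heval ρ⟩
    · exact Or.inr (Or.inl ⟨ha, ρ 0, hp 0, hn _ (Finset.mem_singleton_self _),
        eval_seq_dOp2 _ x y 0 ρ⟩)
    · exact Or.inr (Or.inr (Or.inl ⟨ha, hn _ (Finset.mem_singleton_self _), hp 0⟩))
    · subst ha
      exact Or.inr (Or.inr (Or.inr ⟨rfl, hp 0⟩))
  · rintro (⟨ha, μ, ν, hμ, hν, rfl⟩ | ⟨ha, μ, hμ, hy, rfl⟩ | ⟨ha, hx, hπ⟩ | ⟨rfl, hπ⟩)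
    · exact ⟨_, Or.inl (Or.inl (Or.inl ⟨ha, rfl⟩)), ![μ, ν], Fin.forall_fin_two.2 ⟨hμ, hν⟩,
        by simp, (heval ![μ, ν]).symm⟩
    · exact ⟨_, Or.inl (Or.inl (Or.inr ⟨ha, rfl⟩)), ![μ], Fin.forall_fin_one.2 hμ,
        fun q hq => by rw [Finset.mem_singleton.1 hq]; exact hy, (eval_seq_dOp2 _ x y 0 ![μ]).symm⟩
    · exact ⟨_, Or.inl (Or.inr ⟨ha, rfl⟩), ![π], Fin.forall_fin_one.2 hπ,
        fun q hq => by rw [Finset.mem_singleton.1 hq]; exact hx, rfl⟩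
    · exact ⟨_, Or.inr ⟨rfl, rfl⟩, ![π], Fin.forall_fin_one.2 hπ, by simp, rfl⟩

end Transitions

/-! ### Moduli of continuity of the operators -/

/-- Cost of a rule in which one argument moves and the other becomes a Dirac term: `c₁` already
accounts for the discounted moving part, while the resting part `c₂` still receives the factor `l`.
This `l` is the source of the recursion `D ≤ c + l * D`. -/
theorem mul_transportCost_map_le {T : Type w} {e : T → T → ℝ≥0∞} {l c₁ c₂ : ℝ≥0∞} {g h : T → T}
    {π π' : PMF T} (hgh : ∀ s t, e (g s) (h t) ≤ e s t + c₂) (hc : l * transportCost e π π' ≤ c₁) :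
    l * transportCost e (π.map g) (π'.map h) ≤ c₁ + l * c₂ :=
  calc l * transportCost e (π.map g) (π'.map h)
      ≤ l * (transportCost e π π' + c₂) := mul_le_mul_right (transportCost_map_le hgh π π') l
    _ ≤ c₁ + l * c₂ := by
      rw [mul_add]
      exact add_le_add_left hc _

theorem mul_transportCost_bind_le {I : Type u} {T : Type w} {e : T → T → ℝ≥0∞} {l c : ℝ≥0∞}
    (hl : l ≠ ∞) (p : PMF I) {f g : I → PMF T} (h : ∀ i, l * transportCost e (f i) (g i) ≤ c) :
    l * transportCost e (p.bind f) (p.bind g) ≤ c := by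
  -- The unscaled mixing bound is applied with `c / l`, so `l = 0` is treated apart.
  rcases eq_or_ne l 0 with rfl | h0
  · rw [zero_mul]
    exact bot_le
  · refine ENNReal.mul_le_of_le_div' (transportCost_bind_le p fun i => ?_)
    rw [ENNReal.le_div_iff_mul_le (Or.inl h0) (Or.inl hl), mul_comm]
    exact h i

section Moduli

variable {A : Type u} {tick : A} {S : Signature.{v}} {P : PTSS S A} {ι : ∀ n, PAOp A n → S n}
  {l : ℝ≥0∞}

/-- The target of a move is again a sequential composition, so non-expansiveness is proved by
induction along the iterates, for all arguments at once. -/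
theorem approxDist_seq_le (hP : IsDisjointExtension ι (paSpec tick) P) (hl : l ≤ 1) (n : ℕ)
    (x y x' y' : Proc S) :
    approxDist P.model l n (.op (ι 2 .seq) ![x, y]) (.op (ι 2 .seq) ![x', y']) ≤
      approxDist P.model l n x x' + approxDist P.model l n y y' := by
  have hM := imageFinite_model P
  induction n generalizing x y x' y' with
  | zero => exact bot_le
  | succ n ih =>
    have key : ∀ x y x' y' : Proc S,
        approxDist P.model l (n + 1) x x' + approxDist P.model l (n + 1) y y' < 1 →
        ∀ a π, P.model (.op (ι 2 .seq) ![x, y]) a π →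
          ∃ π', P.model (.op (ι 2 .seq) ![x', y']) a π' ∧
            l * transportCost (approxDist P.model l n) π π' ≤
              approxDist P.model l (n + 1) x x' + approxDist P.model l (n + 1) y y' := by
      intro x y x' y' hlt a π hπ
      have hx := le_self_add.trans_lt hlt
      have hy := le_add_self.trans_lt hlt
      rcases (model_seq_iff hP x y a π).1 hπ with ⟨ha, μ, hμ, rfl⟩ | ⟨⟨μ, hμ⟩, hπ⟩
      · obtain ⟨μ', hμ', hle⟩ := exists_of_bisimulationDist_lt_one hM hx hμ
        refine ⟨_, (model_seq_iff hP x' y' a _).2 (Or.inl ⟨ha, μ', hμ', rfl⟩), ?_⟩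
        refine (mul_transportCost_map_le (fun s t => ih s y t y') hle).trans ?_
        -- The resting argument is measured at level `n` with a discount; dropping the discount and
        -- raising the level both only increase the bound.
        exact add_le_add_right ((mul_le_of_le_one_left' hl).trans (approxDist_le_succ hM n y y')) _
      · obtain ⟨μ', hμ', -⟩ := exists_of_bisimulationDist_lt_one hM hx hμ
        obtain ⟨π', hπ', hle⟩ := exists_of_bisimulationDist_lt_one hM hy hπ
        -- The target of the terminating step is discarded by the rule, so only the existence of
        -- `μ'` matters and the cost comes from `y` alone.
        exact ⟨π', (model_seq_iff hP x' y' a _).2 (Or.inr ⟨⟨μ', hμ'⟩, hπ'⟩),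
          hle.trans le_add_self⟩
    refine bisimulationDist_le (key x y x' y') ?_
    rw [approxDist_comm _ x, approxDist_comm _ y]
    exact key x' y' x y

theorem approxDist_async_le (hP : IsDisjointExtension ι (paSpec tick) P) (hl : l ≤ 1) (n : ℕ)
    (x y x' y' : Proc S) :
    approxDist P.model l n (.op (ι 2 .async) ![x, y]) (.op (ι 2 .async) ![x', y']) ≤
      approxDist P.model l n x x' + approxDist P.model l n y y' := by
  have hM := imageFinite_model P
  induction n generalizing x y x' y' with
  | zero => exact bot_le
  | succ n ih =>
    have key : ∀ x y x' y' : Proc S,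
        approxDist P.model l (n + 1) x x' + approxDist P.model l (n + 1) y y' < 1 →
        ∀ a π, P.model (.op (ι 2 .async) ![x, y]) a π →
          ∃ π', P.model (.op (ι 2 .async) ![x', y']) a π' ∧
            l * transportCost (approxDist P.model l n) π π' ≤
              approxDist P.model l (n + 1) x x' + approxDist P.model l (n + 1) y y' := by
      intro x y x' y' hlt a π hπ
      have hx := le_self_add.trans_lt hlt
      have hy := le_add_self.trans_lt hlt
      rcases (model_async_iff hP x y a π).1 hπ with
        ⟨ha, μ, hμ, rfl⟩ | ⟨ha, ν, hν, rfl⟩ | ⟨rfl, ⟨μ, hμ⟩, ⟨ν, hν⟩, rfl⟩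
      · obtain ⟨μ', hμ', hle⟩ := exists_of_bisimulationDist_lt_one hM hx hμ
        refine ⟨_, (model_async_iff hP x' y' a _).2 (Or.inl ⟨ha, μ', hμ', rfl⟩), ?_⟩
        refine (mul_transportCost_map_le (fun s t => ih s y t y') hle).trans ?_
        exact add_le_add_right ((mul_le_of_le_one_left' hl).trans (approxDist_le_succ hM n y y')) _
      · obtain ⟨ν', hν', hle⟩ := exists_of_bisimulationDist_lt_one hM hy hν
        refine ⟨_, (model_async_iff hP x' y' a _).2 (Or.inr (Or.inl ⟨ha, ν', hν', rfl⟩)), ?_⟩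
        refine (mul_transportCost_map_le
          (fun s t => (ih x s x' t).trans (add_comm _ _).le) hle).trans ?_
        rw [add_comm]
        exact add_le_add_left ((mul_le_of_le_one_left' hl).trans (approxDist_le_succ hM n x x')) _
      · obtain ⟨μ', hμ', -⟩ := exists_of_bisimulationDist_lt_one hM hx hμ
        obtain ⟨ν', hν', -⟩ := exists_of_bisimulationDist_lt_one hM hy hν
        refine ⟨_, (model_async_iff hP x' y' _ _).2
          (Or.inr (Or.inr ⟨rfl, ⟨μ', hμ'⟩, ⟨ν', hν'⟩, rfl⟩)), ?_⟩
        -- Joint termination leads to `δ(0)` on both sides.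
        rw [transportCost_self (approxDist_self n), mul_zero]
        exact bot_le
    refine bisimulationDist_le (key x y x' y') ?_
    rw [approxDist_comm _ x, approxDist_comm _ y]
    exact key x' y' x y

theorem limitDist_seq_le (hP : IsDisjointExtension ι (paSpec tick) P) (hl : l ≤ 1)
    (x y x' y' : Proc S) :
    limitDist P.model l (.op (ι 2 .seq) ![x, y]) (.op (ι 2 .seq) ![x', y']) ≤
      limitDist P.model l x x' + limitDist P.model l y y' :=
  iSup_le fun n => (approxDist_seq_le hP hl n x y x' y').trans
    (add_le_add (approxDist_le_limitDist n x x') (approxDist_le_limitDist n y y'))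

theorem limitDist_async_le (hP : IsDisjointExtension ι (paSpec tick) P) (hl : l ≤ 1)
    (x y x' y' : Proc S) :
    limitDist P.model l (.op (ι 2 .async) ![x, y]) (.op (ι 2 .async) ![x', y']) ≤
      limitDist P.model l x x' + limitDist P.model l y y' :=
  iSup_le fun n => (approxDist_async_le hP hl n x y x' y').trans
    (add_le_add (approxDist_le_limitDist n x x') (approxDist_le_limitDist n y y'))

theorem exists_of_limitDist_lt_one {M : PTS S A} (hM : ImageFinite M) (hl : l < 1)
    {s t : Proc S} (h : limitDist M l s t < 1) {a : A} {π : PMF (Proc S)} (hπ : M s a π) :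
    ∃ π', M t a π' ∧ l * transportCost (limitDist M l) π π' ≤ limitDist M l s t := by
  have hfix := congrFun₂ (bisimulationDist_limitDist hM hl) s t
  rw [← hfix] at h ⊢
  exact exists_of_bisimulationDist_lt_one hM h hπ

/-- Processes at distance below `1` enable the same labels. This transfers the negative premises of
the probabilistic Kleene star. -/
theorem not_exists_of_limitDist_lt_one {M : PTS S A} (hM : ImageFinite M) (hl : l < 1)
    {s t : Proc S} (h : limitDist M l s t < 1) {a : A} (hs : ∀ π, ¬ M s a π) (π : PMF (Proc S)) :
    ¬ M t a π := by
  intro hπ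
  rw [limitDist_comm] at h
  obtain ⟨π', hπ', -⟩ := exists_of_limitDist_lt_one hM hl h hπ
  exact hs π' hπ'

/-- Since the limit is a fixed point, one round of the game suffices. The bound `c` may itself
contain `limitDist M l s t`, which is what the iteration operators exploit. -/
theorem limitDist_le {M : PTS S A} (hM : ImageFinite M) (hl : l < 1) {s t : Proc S} {c : ℝ≥0∞}
    (h : c < 1 → ∀ a π, M s a π → ∃ π', M t a π' ∧ l * transportCost (limitDist M l) π π' ≤ c)
    (h' : c < 1 → ∀ a π, M t a π → ∃ π', M s a π' ∧ l * transportCost (limitDist M l) π π' ≤ c) :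
    limitDist M l s t ≤ c := by
  rw [← congrFun₂ (bisimulationDist_limitDist hM hl) s t]
  exact bisimulationDist_le h h'

/-- After one step of the body the same pair of iterations is left over as the second argument of a
sequential composition, one discount later. -/
theorem limitDist_omega_le (hP : IsDisjointExtension ι (paSpec tick) P) (hl : l < 1)
    (x x' : Proc S) :
    limitDist P.model l (.op (ι 1 .omega) ![x]) (.op (ι 1 .omega) ![x']) ≤
      limitDist P.model l x x' +
        l * limitDist P.model l (.op (ι 1 .omega) ![x]) (.op (ι 1 .omega) ![x']) := by
  have hM := imageFinite_model P
  have key : ∀ x x' : Proc S, limitDist P.model l x x' +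
        l * limitDist P.model l (.op (ι 1 .omega) ![x]) (.op (ι 1 .omega) ![x']) < 1 →
      ∀ a π, P.model (.op (ι 1 .omega) ![x]) a π →
        ∃ π', P.model (.op (ι 1 .omega) ![x']) a π' ∧
          l * transportCost (limitDist P.model l) π π' ≤ limitDist P.model l x x' +
            l * limitDist P.model l (.op (ι 1 .omega) ![x]) (.op (ι 1 .omega) ![x']) := by
    intro x x' hlt a π hπ
    obtain ⟨ha, μ, hμ, rfl⟩ := (model_omega_iff hP x a π).1 hπ
    obtain ⟨μ', hμ', hle⟩ := exists_of_limitDist_lt_one hM hl (le_self_add.trans_lt hlt) hμ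
    exact ⟨_, (model_omega_iff hP x' a _).2 ⟨ha, μ', hμ', rfl⟩,
      mul_transportCost_map_le (fun s t => limitDist_seq_le hP hl.le s _ t _) hle⟩
  refine limitDist_le hM hl (key x x') ?_
  rw [limitDist_comm x, limitDist_comm (.op _ _)]
  exact key x' x

theorem limitDist_bang_le (hP : IsDisjointExtension ι (paSpec tick) P) (hl : l < 1)
    (x x' : Proc S) :
    limitDist P.model l (.op (ι 1 .bang) ![x]) (.op (ι 1 .bang) ![x']) ≤
      limitDist P.model l x x' +
        l * limitDist P.model l (.op (ι 1 .bang) ![x]) (.op (ι 1 .bang) ![x']) := by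
  have hM := imageFinite_model P
  have key : ∀ x x' : Proc S, limitDist P.model l x x' +
        l * limitDist P.model l (.op (ι 1 .bang) ![x]) (.op (ι 1 .bang) ![x']) < 1 →
      ∀ a π, P.model (.op (ι 1 .bang) ![x]) a π →
        ∃ π', P.model (.op (ι 1 .bang) ![x']) a π' ∧
          l * transportCost (limitDist P.model l) π π' ≤ limitDist P.model l x x' +
            l * limitDist P.model l (.op (ι 1 .bang) ![x]) (.op (ι 1 .bang) ![x']) := by
    intro x x' hlt a π hπ
    obtain ⟨ha, μ, hμ, rfl⟩ := (model_bang_iff hP x a π).1 hπ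
    obtain ⟨μ', hμ', hle⟩ := exists_of_limitDist_lt_one hM hl (le_self_add.trans_lt hlt) hμ
    exact ⟨_, (model_bang_iff hP x' a _).2 ⟨ha, μ', hμ', rfl⟩,
      mul_transportCost_map_le (fun s t => limitDist_async_le hP hl.le s _ t _) hle⟩
  refine limitDist_le hM hl (key x x') ?_
  rw [limitDist_comm x, limitDist_comm (.op _ _)]
  exact key x' x

theorem limitDist_star_le (hP : IsDisjointExtension ι (paSpec tick) P) (hl : l < 1)
    (x y x' y' : Proc S) :
    limitDist P.model l (.op (ι 2 .star) ![x, y]) (.op (ι 2 .star) ![x', y']) ≤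
      limitDist P.model l x x' + limitDist P.model l y y' +
        l * limitDist P.model l (.op (ι 2 .star) ![x, y]) (.op (ι 2 .star) ![x', y']) := by
  have hM := imageFinite_model P
  have key : ∀ x y x' y' : Proc S, limitDist P.model l x x' + limitDist P.model l y y' +
        l * limitDist P.model l (.op (ι 2 .star) ![x, y]) (.op (ι 2 .star) ![x', y']) < 1 →
      ∀ a π, P.model (.op (ι 2 .star) ![x, y]) a π →
        ∃ π', P.model (.op (ι 2 .star) ![x', y']) a π' ∧
          l * transportCost (limitDist P.model l) π π' ≤
            limitDist P.model l x x' + limitDist P.model l y y' +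
              l * limitDist P.model l (.op (ι 2 .star) ![x, y]) (.op (ι 2 .star) ![x', y']) := by
    intro x y x' y' hlt a π hπ
    have hxy := le_self_add.trans_lt hlt
    rcases (model_star_iff hP x y a π).1 hπ with ⟨ha, μ, hμ, rfl⟩ | hπ
    · obtain ⟨μ', hμ', hle⟩ := exists_of_limitDist_lt_one hM hl (le_self_add.trans_lt hxy) hμ
      exact ⟨_, (model_star_iff hP x' y' a _).2 (Or.inl ⟨ha, μ', hμ', rfl⟩),
        mul_transportCost_map_le (fun s t => limitDist_seq_le hP hl.le s _ t _)
          (hle.trans le_self_add)⟩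
    · obtain ⟨π', hπ', hle⟩ := exists_of_limitDist_lt_one hM hl (le_add_self.trans_lt hxy) hπ
      exact ⟨π', (model_star_iff hP x' y' a _).2 (Or.inr hπ'),
        (hle.trans le_add_self).trans le_self_add⟩
  refine limitDist_le hM hl (key x y x' y') ?_
  rw [limitDist_comm x, limitDist_comm y, limitDist_comm (.op _ _)]
  exact key x' y' x y

/-- Matching moves use the same rule on both sides, since the enabled labels of the arguments agree.
-/
theorem limitDist_starP_le (hP : IsDisjointExtension ι (paSpec tick) P) (hl : l < 1)
    (p : Set.Ioo (0 : ℝ) 1) (x y x' y' : Proc S) :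
    limitDist P.model l (.op (ι 2 (.starP p)) ![x, y]) (.op (ι 2 (.starP p)) ![x', y']) ≤
      limitDist P.model l x x' + limitDist P.model l y y' +
        l * limitDist P.model l (.op (ι 2 (.starP p)) ![x, y])
          (.op (ι 2 (.starP p)) ![x', y']) := by
  have hM := imageFinite_model P
  have key : ∀ x y x' y' : Proc S, limitDist P.model l x x' + limitDist P.model l y y' +
        l * limitDist P.model l (.op (ι 2 (.starP p)) ![x, y])
          (.op (ι 2 (.starP p)) ![x', y']) < 1 →
      ∀ a π, P.model (.op (ι 2 (.starP p)) ![x, y]) a π →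
        ∃ π', P.model (.op (ι 2 (.starP p)) ![x', y']) a π' ∧
          l * transportCost (limitDist P.model l) π π' ≤
            limitDist P.model l x x' + limitDist P.model l y y' +
              l * limitDist P.model l (.op (ι 2 (.starP p)) ![x, y])
                (.op (ι 2 (.starP p)) ![x', y']) := by
    intro x y x' y' hlt a π hπ
    have hxy := le_self_add.trans_lt hlt
    have hx := le_self_add.trans_lt hxy
    have hy := le_add_self.trans_lt hxy
    rcases (model_starP_iff hP p x y a π).1 hπ with ⟨ha, μ, ν, hμ, hν, rfl⟩ |
      ⟨ha, μ, hμ, hny, rfl⟩ | ⟨ha, hnx, hπ⟩ | ⟨ha, hπ⟩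
    · obtain ⟨μ', hμ', hleμ⟩ := exists_of_limitDist_lt_one hM hl hx hμ
      obtain ⟨ν', hν', hleν⟩ := exists_of_limitDist_lt_one hM hl hy hν
      refine ⟨_, (model_starP_iff hP p x' y' a _).2
        (Or.inl ⟨ha, μ', ν', hμ', hν', rfl⟩), ?_⟩
      refine mul_transportCost_bind_le (hl.trans ENNReal.one_lt_top).ne (coin p) ?_
      -- Both processes toss the same coin, so it is enough to bound each outcome: `false` continues
      -- the iteration, `true` exits into the second argument.
      rintro (_ | _)
      · exact mul_transportCost_map_le (fun s t => limitDist_seq_le hP hl.le s _ t _)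
          (hleμ.trans le_self_add)
      · exact (hleν.trans le_add_self).trans le_self_add
    · obtain ⟨μ', hμ', hle⟩ := exists_of_limitDist_lt_one hM hl hx hμ
      exact ⟨_, (model_starP_iff hP p x' y' a _).2 (Or.inr (Or.inl
          ⟨ha, μ', hμ', not_exists_of_limitDist_lt_one hM hl hy hny, rfl⟩)),
        mul_transportCost_map_le (fun s t => limitDist_seq_le hP hl.le s _ t _)
          (hle.trans le_self_add)⟩
    · obtain ⟨π', hπ', hle⟩ := exists_of_limitDist_lt_one hM hl hy hπ
      exact ⟨π', (model_starP_iff hP p x' y' a _).2 (Or.inr (Or.inr (Or.inl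
          ⟨ha, not_exists_of_limitDist_lt_one hM hl hx hnx, hπ'⟩))),
        (hle.trans le_add_self).trans le_self_add⟩
    · obtain ⟨π', hπ', hle⟩ := exists_of_limitDist_lt_one hM hl hy hπ
      exact ⟨π', (model_starP_iff hP p x' y' a _).2 (Or.inr (Or.inr (Or.inr ⟨ha, hπ'⟩))),
        (hle.trans le_add_self).trans le_self_add⟩
  refine limitDist_le hM hl (key x y x' y') ?_
  rw [limitDist_comm x, limitDist_comm y, limitDist_comm (.op _ _)]
  exact key x' y' x y

end Moduli

/-! ### From the recursive inequality to the Lipschitz factor -/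

theorem bisimilarityMetric_le_of_limitDist_le {S : Signature.{v}} {A : Type u} {M : PTS S A}
    (hM : ImageFinite M) {lam : ℝ} (hlam₀ : 0 ≤ lam) (hlam₁ : lam < 1) {s t : Proc S} {c : ℝ≥0∞}
    (hc : c ≠ ∞) (h : limitDist M (ENNReal.ofReal lam) s t ≤
      c + ENNReal.ofReal lam * limitDist M (ENNReal.ofReal lam) s t) :
    bisimilarityMetric M lam s t ≤ 1 / (1 - lam) * c.toReal := by
  -- Finiteness is essential: with `∞` on both sides the inequality would say nothing, and the
  -- subtraction is carried out in the reals.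
  have hmul : ENNReal.ofReal lam * limitDist M (ENNReal.ofReal lam) s t ≠ ∞ :=
    ENNReal.mul_ne_top ENNReal.ofReal_ne_top (limitDist_ne_top s t)
  have h' := ENNReal.toReal_mono (ENNReal.add_ne_top.2 ⟨hc, hmul⟩) h
  rw [ENNReal.toReal_add hc hmul, ENNReal.toReal_mul, ENNReal.toReal_ofReal hlam₀,
    ← bisimilarityMetric_eq hM hlam₀ hlam₁] at h'
  rw [one_div_mul_eq_div, le_div_iff₀ (sub_pos.2 hlam₁)]
  linarith

theorem isLipschitzOp_one {S : Signature.{v}} {A : Type u} {M : PTS S A} (hM : ImageFinite M)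
    {lam : ℝ} (hlam₀ : 0 ≤ lam) (hlam₁ : lam < 1) {f : S 1}
    (h : ∀ x x', limitDist M (ENNReal.ofReal lam) (.op f ![x]) (.op f ![x']) ≤
      limitDist M (ENNReal.ofReal lam) x x' +
        ENNReal.ofReal lam * limitDist M (ENNReal.ofReal lam) (.op f ![x]) (.op f ![x'])) :
    IsLipschitzOp (bisimilarityMetric M lam) (1 / (1 - lam)) f := by
  refine ⟨one_div_nonneg.2 (sub_nonneg.2 hlam₁.le), fun s t => ?_⟩
  have hs : ∀ s : Fin 1 → Proc S, ![s 0] = s := fun s => by ext i; fin_cases i; rfl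
  have key := bisimilarityMetric_le_of_limitDist_le hM hlam₀ hlam₁ (limitDist_ne_top _ _)
    (h (s 0) (t 0))
  rw [hs, hs, ← bisimilarityMetric_eq hM hlam₀ hlam₁] at key
  rwa [Fin.sum_univ_one]

theorem isLipschitzOp_two {S : Signature.{v}} {A : Type u} {M : PTS S A} (hM : ImageFinite M)
    {lam : ℝ} (hlam₀ : 0 ≤ lam) (hlam₁ : lam < 1) {f : S 2}
    (h : ∀ x y x' y', limitDist M (ENNReal.ofReal lam) (.op f ![x, y]) (.op f ![x', y']) ≤
      limitDist M (ENNReal.ofReal lam) x x' + limitDist M (ENNReal.ofReal lam) y y' +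
        ENNReal.ofReal lam *
          limitDist M (ENNReal.ofReal lam) (.op f ![x, y]) (.op f ![x', y'])) :
    IsLipschitzOp (bisimilarityMetric M lam) (1 / (1 - lam)) f := by
  refine ⟨one_div_nonneg.2 (sub_nonneg.2 hlam₁.le), fun s t => ?_⟩
  have hs : ∀ s : Fin 2 → Proc S, ![s 0, s 1] = s := fun s => by ext i; fin_cases i <;> rfl
  have key := bisimilarityMetric_le_of_limitDist_le hM hlam₀ hlam₁
    (ENNReal.add_ne_top.2 ⟨limitDist_ne_top _ _, limitDist_ne_top _ _⟩)
    (h (s 0) (s 1) (t 0) (t 1))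
  rw [hs, hs, ENNReal.toReal_add (limitDist_ne_top _ _) (limitDist_ne_top _ _),
    ← bisimilarityMetric_eq hM hlam₀ hlam₁, ← bisimilarityMetric_eq hM hlam₀ hlam₁] at key
  rwa [Fin.sum_univ_two]

end ProcCalc

theorem mainTheorem8 {A : Type*} (tick : A) {S : ℕ → Type*} (P : PTSS S A)
    (ι : ∀ n, PAOp A n → S n) (hP : IsDisjointExtension ι (paSpec tick) P)
    (lam : ℝ) (hlam₀ : 0 < lam) (hlam₁ : lam < 1) :
    IsLeast {d | IsBisimulationMetric P.model lam d} (bisimilarityMetric P.model lam) ∧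
    IsLipschitzOp (bisimilarityMetric P.model lam) (1 / (1 - lam)) (ι 1 .omega) ∧
    IsLipschitzOp (bisimilarityMetric P.model lam) (1 / (1 - lam)) (ι 2 .star) ∧
    (∀ p : Set.Ioo (0 : ℝ) 1,
      IsLipschitzOp (bisimilarityMetric P.model lam) (1 / (1 - lam)) (ι 2 (.starP p))) ∧
    IsLipschitzOp (bisimilarityMetric P.model lam) (1 / (1 - lam)) (ι 1 .bang) := by
  have hM := imageFinite_model P
  have hl : ENNReal.ofReal lam < 1 := ENNReal.ofReal_lt_one.2 hlam₁
  exact ⟨isLeast_bisimilarityMetric hM hlam₀.le hlam₁,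
    isLipschitzOp_one hM hlam₀.le hlam₁ (limitDist_omega_le hP hl),
    isLipschitzOp_two hM hlam₀.le hlam₁ (limitDist_star_le hP hl),
    fun p => isLipschitzOp_two hM hlam₀.le hlam₁ (limitDist_starP_le hP hl p),
    isLipschitzOp_one hM hlam₀.le hlam₁ (limitDist_bang_le hP hl)⟩
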